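/- Let $C_{m,n}$ ($m,n\ge 1$) be the annulus with $m$ equally spaced marked points $P_i$ ($i\in\mathbb Z/m$) on its outer boundary circle and $n$ equally spaced marked points on its inner boundary circle, numbered anticlockwise. An \emph{arc} is a homotopy class (with fixed end points, orientation disregarded) of curves joining marked points that has a representative without self-intersections meeting the boundary only at its end points, and that is not contractible to a marked point or to a boundary segment between consecutive marked points. Two arcs are compatible if they have such representatives that do not meet in the interior of the annulus. A \emph{triangulation} is a maximal collection of pairwise compatible arcs. It is \emph{skeletal} if each of its arcs joins the two different boundary components. Its outer quiddity sequence is $(a_i)_{i\in\mathbb Z/m}$, where $a_i$ is the number of triangles at $P_i$ (a triangle with several corners at $P_i$ is counted once for each of them). An infinite periodic frieze is an array with a row of $0$'s, a row of $1$'s and then infinitely many rows of positive integers, satisfying the determinant rule (left)(right) $-$ (top)(bottom) $=1$ in every diamond, whose first row after the $1$'s (the quiddity row) is periodic. An $m$-tuple $q=(q_i)_{i\in\mathbb Z/m}$ is a quiddity sequence if its periodic continuation is the quiddity row of such a frieze. It is \emph{skeletal} if moreover no $q_i$ equals $1$ and $q\neq(2,2,\dots,2)$. \textbf{Proposition.}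 Let $m\ge1$ and let $q=(q_i)_{i\in\mathbb Z/m}$ be a skeletal quiddity sequence. Then there are $n\ge 1$ and a skeletal triangulation $\mathcal T$ of $C_{m,n}$ whose outer quiddity sequence is $q$ (so the frieze of the outer boundary has quiddity sequence $q$). It is unique up to rotating the inner boundary and its marked points: if $\mathcal T'$ is a skeletal triangulation of some $C_{m,n'}$, $n'\ge1$, with outer quiddity sequence $q$, then $n'=n$ and $\mathcal T'$ is the image of $\mathcal T$ under a homeomorphism of the annulus that fixes the outer boundary pointwise and rotates the inner boundary by $k/n$ of a full turn for some $k\in\mathbb Z$, with the angle interpolated linearly in between. More generally, if the outer quiddity sequence of $\mathcal T'$ is the cyclic shift $(q_{i+c})_{i\in\mathbb Z/m}$ of $q$, $c\in\mathbb Z$, then $n'=n$ and $\mathcal T'$ is obtained from $\mathcal T$ by such a rotation of the inner boundary together with the rotation of the outer boundary by $-c/m$ of a full turn. -/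

import Mathlib

open Set unitInterval

noncomputable section

namespace AnnulusFrieze

/-! ### Infinite periodic friezes -/

/-- An infinite frieze: `F k i` is the `i`-th entry of the `k`-th row (rows counted from `0`). Row `0`
consists of zeros, row `1` of ones, all later rows consist of positive integers, and every diamond
with top `F k (i + 1)`, left `F (k + 1) i`, right `F (k + 1) (i + 1)` and bottom `F (k + 2) i`
satisfies the determinant rule. The quiddity row is row `2`. -/
structure IsInfiniteFrieze (F : ℕ → ℤ → ℤ) : Prop where
  zero_row : ∀ i, F 0 i = 0
  one_row : ∀ i, F 1 i = 1
  pos : ∀ k i, 0 < F (k + 2) i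
  diamond : ∀ k i, F (k + 1) i * F (k + 1) (i + 1) - F k (i + 1) * F (k + 2) i = 1

/-- The `m`-tuple `q`, indexed cyclically, is a quiddity sequence of some infinite periodic frieze:
the quiddity row of the frieze is the periodic continuation of `q`. -/
def IsQuiddity (m : ℕ) (q : ZMod m → ℕ) : Prop :=
  ∃ F : ℕ → ℤ → ℤ, IsInfiniteFrieze F ∧ ∀ i : ℤ, F 2 i = (q (i : ZMod m) : ℤ)

/-- A skeletal quiddity sequence: a quiddity sequence of an infinite periodic frieze that contains
no `1` (so that no reduction applies to it) and that is different from `(2, 2, …, 2)`. -/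
structure IsSkeletalQuiddity (m : ℕ) (q : ZMod m → ℕ) : Prop where
  quiddity : IsQuiddity m q
  reduced : ∀ i, q i ≠ 1
  nontrivial : ∃ i, q i ≠ 2

/-! ### The annulus with marked points -/

/-- The closed annulus `S¹ × [0, 1]`. The circle `t = 0` is the outer boundary and the circle
`t = 1` is the inner boundary. -/
abbrev Annulus : Type := UnitAddCircle × I

/-- The universal covering `ℝ × [0, 1] → S¹ × [0, 1]`. -/
def proj (x : ℝ) (t : I) : Annulus := ((x : UnitAddCircle), t)

/-- The boundary of the annulus. -/
def boundary : Set Annulus := {p | p.2 = 0 ∨ p.2 = 1}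

/-- The marked points on the outer boundary, labelled by `ℤ` with period `m`. -/
def outerPt (m : ℕ) (i : ℤ) : Annulus := proj ((i : ℝ) / m) 0

/-- The marked points on the inner boundary, labelled by `ℤ` with period `n`. -/
def innerPt (n : ℕ) (j : ℤ) : Annulus := proj ((j : ℝ) / n) 1

/-- The marked points of the annulus `C_{m,n}`. -/
def marked (m n : ℕ) : Set Annulus := range (outerPt m) ∪ range (innerPt n)

/-- The path in the circle at height `t` that is covered by the segment from `a` to `b`. -/
def circlePath (t : I) (a b : ℝ) : Path (proj a t) (proj b t) where
  toFun s := proj (a + (s : ℝ) * (b - a)) t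
  continuous_toFun := by
    unfold proj
    exact ((AddCircle.continuous_mk' (1 : ℝ)).comp (by fun_prop)).prodMk continuous_const
  source' := by simp
  target' := by simp

/-! ### Arcs and triangulations -/

/-- A curve in the annulus up to homotopy with fixed end points (with an orientation). -/
structure CurveClass where
  source : Annulus
  target : Annulus
  cls : Path.Homotopic.Quotient source target

/-- The class with the opposite orientation. -/
def CurveClass.reverse (e : CurveClass) : CurveClass := ⟨e.target, e.source, e.cls.symm⟩

/-- The boundary segments of `C_{m,n}`, in both orientations: the pieces of the boundary between
consecutive marked points. -/
inductive IsBoundarySegment (m n : ℕ) : CurveClass → Prop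
  | outer (i : ℤ) : IsBoundarySegment m n
      ⟨outerPt m i, outerPt m (i + 1),
        .mk ((circlePath 0 ((i : ℝ) / m) (((i + 1 : ℤ) : ℝ) / m)))⟩
  | inner (j : ℤ) : IsBoundarySegment m n
      ⟨innerPt n j, innerPt n (j + 1),
        .mk ((circlePath 1 ((j : ℝ) / n) (((j + 1 : ℤ) : ℝ) / n)))⟩
  | reverse (e : CurveClass) : IsBoundarySegment m n e → IsBoundarySegment m n e.reverse

/-- The curve `γ` has no self-intersections (its end points may coincide), and it meets the boundary
only at its end points. -/
def IsSimpleCurve {x y : Annulus} (γ : Path x y) : Prop :=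
  InjOn γ (Ioo 0 1) ∧ ∀ s ∈ Ioo (0 : I) 1, γ s ∉ boundary

/-- The arcs of `C_{m,n}`: homotopy classes of curves that join marked points and have a simple
representative, and that are not contractible to a marked point or to a boundary segment. -/
structure IsArc (m n : ℕ) (e : CurveClass) : Prop where
  source_mem : e.source ∈ marked m n
  target_mem : e.target ∈ marked m n
  simple : ∃ γ : Path e.source e.target, .mk γ = e.cls ∧ IsSimpleCurve γ
  not_const : ∀ p : Annulus, e ≠ ⟨p, p, .refl p⟩
  not_boundary : ¬ IsBoundarySegment m n e

/-- Two arcs are compatible if they have simple representatives that do not meet inside the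
annulus. -/
def Compatible (e f : CurveClass) : Prop :=
  ∃ (γ : Path e.source e.target) (δ : Path f.source f.target),
    .mk γ = e.cls ∧ .mk δ = f.cls ∧ IsSimpleCurve γ ∧ IsSimpleCurve δ ∧
      Disjoint (γ '' Ioo 0 1) (δ '' Ioo 0 1)

/-- A triangulation of `C_{m,n}`: a maximal collection of pairwise compatible arcs. An unoriented
arc is represented by its two orientations. -/
structure Triangulation (m n : ℕ) where
  arcs : Set CurveClass
  reverse_mem : ∀ e ∈ arcs, e.reverse ∈ arcs
  isArc : ∀ e ∈ arcs, IsArc m n e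
  compatible : ∀ e ∈ arcs, ∀ f ∈ arcs, Compatible e f
  maximal : ∀ f, IsArc m n f → (∀ e ∈ arcs, Compatible e f) → f ∈ arcs

/-- A bridging arc joins the two boundary components. -/
def IsBridging (e : CurveClass) : Prop := e.source.2 ≠ e.target.2

/-- A skeletal triangulation is a triangulation with only bridging arcs. -/
def Triangulation.IsSkeletal {m n : ℕ} (T : Triangulation m n) : Prop :=
  ∀ e ∈ T.arcs, IsBridging e

/-- The possible sides of the triangles of a triangulation: its arcs and the boundary segments. -/
def Triangulation.IsSide {m n : ℕ} (T : Triangulation m n) (e : CurveClass) : Prop :=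
  e ∈ T.arcs ∨ IsBoundarySegment m n e

/-- The number of triangles of `T` at the point `p`. A triangle with a corner at `p` is given by the
unordered pair of its two sides `e`, `f` that start at `p` in that corner; the third side is the
class of `e⁻¹ f`. Since corners are counted, a triangle that has several of its corners at `p` counts
with multiplicity (this is the number of triangles at a lift of `p` to the universal cover). -/
def Triangulation.trianglesAt {m n : ℕ} (T : Triangulation m n) (p : Annulus) : ℕ :=
  {c : Sym2 (Σ y : Annulus, Path.Homotopic.Quotient p y) | ∃ e f, c = s(e, f) ∧
    T.IsSide ⟨p, e.1, e.2⟩ ∧ T.IsSide ⟨p, f.1, f.2⟩ ∧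
    T.IsSide ⟨e.1, f.1, e.2.symm.trans f.2⟩}.ncard

/-- The quiddity sequence of `T` at the outer boundary: the numbers of triangles at the marked
points, in their cyclic order. -/
def Triangulation.outerQuiddity {m n : ℕ} (T : Triangulation m n) : ZMod m → ℕ :=
  fun i => T.trianglesAt (outerPt m (i.val : ℤ))

/-! ### Rotating the boundary components -/

/-- The self-map of the annulus that rotates the outer boundary by `a` full turns, the inner boundary
by `b` full turns, and interpolates linearly in between. -/
def rotateMap (a b : ℝ) (p : Annulus) : Annulus :=
  (p.1 + (((1 - (p.2 : ℝ)) * a + (p.2 : ℝ) * b : ℝ) : UnitAddCircle), p.2)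

theorem continuous_rotateMap (a b : ℝ) : Continuous (rotateMap a b) := by
  unfold rotateMap
  refine Continuous.prodMk (continuous_fst.add ?_) continuous_snd
  exact (AddCircle.continuous_mk' (1 : ℝ)).comp (by fun_prop)

theorem rotateMap_neg_rotateMap (a b : ℝ) (p : Annulus) :
    rotateMap (-a) (-b) (rotateMap a b p) = p := by
  unfold rotateMap
  refine Prod.ext ?_ rfl
  simp only [add_assoc, ← AddCircle.coe_add]
  ring_nf
  simp

/-- `rotateMap a b` as a homeomorphism of the annulus. For `a = 0` it fixes the outer boundary
pointwise and rotates the inner boundary by `b` turns. -/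
def rotate (a b : ℝ) : Annulus ≃ₜ Annulus where
  toFun := rotateMap a b
  invFun := rotateMap (-a) (-b)
  left_inv := rotateMap_neg_rotateMap a b
  right_inv p := by simpa using rotateMap_neg_rotateMap (-a) (-b) p
  continuous_toFun := continuous_rotateMap a b
  continuous_invFun := continuous_rotateMap (-a) (-b)

/-- The image of a class of curves under a continuous self-map of the annulus. -/
def CurveClass.map (h : C(Annulus, Annulus)) (e : CurveClass) : CurveClass :=
  ⟨h e.source, h e.target, e.cls.map h⟩

end AnnulusFrieze

end

open AnnulusFrieze

noncomputable section

namespace AnnulusFrieze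

/-! ### The universal covering and homotopy classes of curves -/

/-! In the universal cover, the strip `ℝ × I`, an oriented curve class is a pair of points modulo
simultaneous integer translation (`ofLift_eq_iff`). A winding number argument shows that two
bridging curves whose ends are in strictly opposite order must cross, and straight segments show
that nothing else obstructs. So bridging arcs become pairs `(i, j)` of integers modulo `(m, n)`, and
compatibility means that no two lifts reverse order (`compatible_bridge_iff`).

A skeletal triangulation is then a monotone `h : ℤ → ℤ` with `h (i + m) = h i + n`: the arcs at the
outer point `i` end at the inner points from `h i` to `h (i + 1)` (`fanTriangulation`,
`exists_arcs_eq_fan`). These arcs bound `h (i + 1) - h i + 2` triangles at `i`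
(`trianglesAt_outerPt`).

Hence `q` prescribes the increments `q i - 2` of `h`. They are nonnegative and not all zero, so `h`
exists, with `n = ∑ (q i - 2) ≥ 1`. It is unique up to an additive constant, and adding `k` to `h`
rotates the inner boundary by `k / n` (`image_fan_rotate`). -/

/-- The universal covering of the annulus as a continuous map. -/
def cover : C(ℝ × I, Annulus) where
  toFun x := proj x.1 x.2
  continuous_toFun := by
    unfold proj
    exact ((AddCircle.continuous_mk' (1 : ℝ)).comp continuous_fst).prodMk continuous_snd

/-- Makes the strip simply connected, so that a class of lifted curves depends on its end points
alone. -/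
instance : ContractibleSpace I :=
  (convex_Icc (0 : ℝ) 1).contractibleSpace ⟨0, by simp⟩

/-- The class of the curves that lift to curves from `x` to `y` in the strip. -/
def liftCls (x y : ℝ × I) : Path.Homotopic.Quotient (cover x) (cover y) :=
  .mk ((PathConnectedSpace.somePath x y).map cover.continuous)

/-- The class of the curves that lift to curves from `x` to `y` in the strip, with its end points. -/
def ofLift (x y : ℝ × I) : CurveClass := ⟨cover x, cover y, liftCls x y⟩

/-- Lets any convenient path replace the arbitrary one in `liftCls`. -/
theorem mk_map_cover {x y : ℝ × I} (Γ : Path x y) :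
    Path.Homotopic.Quotient.mk (Γ.map cover.continuous) = liftCls x y := by
  refine Path.Homotopic.Quotient.eq.2 ?_
  exact (SimplyConnectedSpace.paths_homotopic Γ _).map cover

/-- Only the circle coordinate has to be lifted; the height is kept. -/
theorem exists_path_lift {x : ℝ × I} {p : Annulus} (γ : Path (cover x) p) :
    ∃ (y : ℝ × I) (_ : cover y = p) (Γ : Path x y), ∀ u, cover (Γ u) = γ u := by
  have cov := AddCircle.isCoveringMap_coe (1 : ℝ)
  obtain ⟨G, hG, hG0⟩ := cov.exists_path_lifts
    ⟨fun u => (γ u).1, continuous_fst.comp γ.continuous⟩ x.1 (by rw [ContinuousMap.coe_mk, γ.source]; rfl)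
  have hlift : ∀ u, cover (G u, (γ u).2) = γ u := fun u =>
    Prod.ext (congrFun hG u) rfl
  refine ⟨(G 1, (γ 1).2), by rw [hlift, γ.target], ⟨⟨fun u => (G u, (γ u).2), by fun_prop⟩, ?_, rfl⟩,
    hlift⟩
  refine Prod.ext hG0 ?_
  change (γ 0).2 = x.2
  rw [γ.source]
  rfl

/-- Pointwise comparison avoids transporting classes along equalities of end points. -/
theorem curveClass_mk_eq {x y x' y' : Annulus} (γ : Path x y) (δ : Path x' y')
    (h : ∀ u, γ u = δ u) :
    (⟨x, y, .mk γ⟩ : CurveClass) = ⟨x', y', .mk δ⟩ := by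
  have hx : x = x' := by simpa using h 0
  have hy : y = y' := by simpa using h 1
  subst hx hy
  obtain rfl : γ = δ := Path.ext (funext h)
  rfl

theorem sigma_mk_eq {x y y' : Annulus} (γ : Path x y) (δ : Path x y')
    (h : ∀ u, γ u = δ u) :
    (⟨y, .mk γ⟩ : Σ y : Annulus, Path.Homotopic.Quotient x y) = ⟨y', .mk δ⟩ := by
  have hy : y = y' := by simpa using h 1
  subst hy
  obtain rfl : γ = δ := Path.ext (funext h)
  rfl

/-- The classes of curves that start at `cover x`, parametrized by the end points of their lifts. -/
def endCls (x y : ℝ × I) : Σ p : Annulus, Path.Homotopic.Quotient (cover x) p :=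
  ⟨cover y, liftCls x y⟩

theorem endCls_surjective (x : ℝ × I) : Function.Surjective (endCls x) := by
  rintro ⟨p, ⟨γ⟩⟩
  obtain ⟨y, rfl, Γ, hΓ⟩ := exists_path_lift γ
  refine ⟨y, ?_⟩
  unfold endCls
  rw [← mk_map_cover Γ]
  exact sigma_mk_eq _ _ hΓ

/-- Monodromy of `ℝ → S¹` recovers the real coordinate of the end point of the lift; its height is
already visible in the annulus. -/
theorem endCls_injective (x : ℝ × I) : Function.Injective (endCls x) := by
  have cov := AddCircle.isCoveringMap_coe (1 : ℝ)
  let φ : (Σ p : Annulus, Path.Homotopic.Quotient (cover x) p) → ℝ := fun e =>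
    (cov.monodromy (e.2.map ⟨Prod.fst, continuous_fst⟩) ⟨x.1, rfl⟩).1
  have hφ : ∀ y, φ (endCls x y) = y.1 := by
    intro y
    let Γ := PathConnectedSpace.somePath x y
    have := cov.monodromy_map (.mk (Γ.map continuous_fst))
    exact congrArg Subtype.val this
  intro y y' h
  refine Prod.ext ?_ ?_
  · rw [← hφ y, ← hφ y', h]
  · exact congrArg (fun e => (Sigma.fst e).2) h

theorem exists_eq_ofLift (e : CurveClass) : ∃ x y, e = ofLift x y := by
  obtain ⟨⟨p, s⟩, q, c⟩ := e
  obtain ⟨a, rfl⟩ := QuotientAddGroup.mk_surjective p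
  obtain ⟨y, hy⟩ := endCls_surjective (a, s) ⟨q, c⟩
  refine ⟨(a, s), y, ?_⟩
  cases hy
  rfl

/-- The deck transformation by `k` turns. -/
def shift (k : ℤ) (x : ℝ × I) : ℝ × I := (x.1 + k, x.2)

theorem cover_shift (k : ℤ) (x : ℝ × I) : cover (shift k x) = cover x := by
  refine Prod.ext ?_ rfl
  simp only [cover, shift, proj, ContinuousMap.coe_mk, AddCircle.coe_add]
  rw [add_eq_left]
  exact (AddCircle.coe_eq_zero_iff (1 : ℝ)).2 ⟨k, by simp⟩

theorem cover_eq_iff {x y : ℝ × I} : cover x = cover y ↔ ∃ k, y = shift k x := by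
  constructor
  · intro h
    have h1 : ((y.1 - x.1 : ℝ) : UnitAddCircle) = 0 := by
      rw [AddCircle.coe_sub, sub_eq_zero]
      exact (congrArg Prod.fst h).symm
    obtain ⟨k, hk⟩ := (AddCircle.coe_eq_zero_iff (1 : ℝ)).1 h1
    refine ⟨k, Prod.ext ?_ (congrArg Prod.snd h).symm⟩
    simp only [shift]
    simp only [zsmul_eq_mul, mul_one] at hk
    linarith
  · rintro ⟨k, rfl⟩
    exact (cover_shift k x).symm

theorem ofLift_shift (k : ℤ) (x y : ℝ × I) : ofLift (shift k x) (shift k y) = ofLift x y := by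
  let Γ := PathConnectedSpace.somePath x y
  have hs : Continuous (shift k) := by unfold shift; fun_prop
  unfold ofLift
  rw [← mk_map_cover Γ, ← mk_map_cover (Γ.map hs)]
  exact curveClass_mk_eq _ _ fun u => cover_shift k _

theorem ofLift_eq_iff {x y x' y' : ℝ × I} :
    ofLift x y = ofLift x' y' ↔ ∃ k, x' = shift k x ∧ y' = shift k y := by
  constructor
  · intro h
    obtain ⟨k, rfl⟩ := cover_eq_iff.1 (congrArg CurveClass.source h)
    refine ⟨k, rfl, ?_⟩
    rw [← ofLift_shift k] at h
    refine endCls_injective (shift k x) ?_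
    unfold ofLift at h
    unfold endCls
    rw [CurveClass.mk.injEq] at h
    simp only [true_and] at h
    exact Sigma.ext h.1.symm h.2.symm
  · rintro ⟨k, rfl, rfl⟩
    exact (ofLift_shift k x y).symm

theorem exists_lift_of_mk_eq {x y : ℝ × I} (γ : Path (cover x) (cover y))
    (h : .mk γ = liftCls x y) : ∃ Γ : Path x y, ∀ u, cover (Γ u) = γ u := by
  obtain ⟨y', hy', Γ, hΓ⟩ := exists_path_lift γ
  obtain rfl : y' = y := by
    refine endCls_injective x ?_
    unfold endCls
    rw [← h, ← mk_map_cover Γ]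
    exact sigma_mk_eq _ _ hΓ
  exact ⟨Γ, hΓ⟩

theorem liftCls_symm (x y : ℝ × I) : (liftCls x y).symm = liftCls y x := by
  rw [← mk_map_cover (PathConnectedSpace.somePath x y).symm]
  rfl

theorem liftCls_trans (x y z : ℝ × I) : (liftCls x y).trans (liftCls y z) = liftCls x z := by
  rw [← mk_map_cover ((PathConnectedSpace.somePath x y).trans (PathConnectedSpace.somePath y z))]
  rw [Path.map_trans]
  rfl

theorem ofLift_reverse (x y : ℝ × I) : (ofLift x y).reverse = ofLift y x := by
  unfold ofLift CurveClass.reverse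
  simp only [liftCls_symm]

theorem refl_eq_ofLift (x : ℝ × I) : (⟨cover x, cover x, .refl (cover x)⟩ : CurveClass) = ofLift x x := by
  unfold ofLift
  rw [← mk_map_cover (Path.refl x)]
  rfl

theorem mk_circlePath (t : I) (a b : ℝ) :
    (⟨proj a t, proj b t, .mk (circlePath t a b)⟩ : CurveClass) = ofLift (a, t) (b, t) := by
  let Γ : Path ((a, t) : ℝ × I) (b, t) :=
    ⟨⟨fun s => (a + (s : ℝ) * (b - a), t), by fun_prop⟩, by simp, by simp⟩
  unfold ofLift
  rw [← mk_map_cover Γ]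
  exact curveClass_mk_eq _ _ fun u => rfl

/-- The lift of `rotateMap` to the strip. -/
def rotateLift (α β : ℝ) (x : ℝ × I) : ℝ × I := (x.1 + ((1 - (x.2 : ℝ)) * α + (x.2 : ℝ) * β), x.2)

theorem map_rotate_ofLift (α β : ℝ) (x y : ℝ × I) :
    (ofLift x y).map (rotate α β : C(Annulus, Annulus)) =
      ofLift (rotateLift α β x) (rotateLift α β y) := by
  let Γ := PathConnectedSpace.somePath x y
  have hs : Continuous (rotateLift α β) := by unfold rotateLift; fun_prop
  unfold ofLift
  rw [← mk_map_cover Γ, ← mk_map_cover (Γ.map hs)]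
  refine curveClass_mk_eq ((Γ.map cover.continuous).map (rotate α β).continuous) _ fun u => ?_
  refine Prod.ext ?_ rfl
  simp only [Path.map_coe, Function.comp_apply]
  generalize Γ u = z
  simp [rotate, rotateMap, rotateLift, cover, proj]

/-! ### Crossing curves in the strip -/

open Complex in
/-- Along a curve in a closed half plane minus the origin, a continuous logarithm changes by the
change of the argument that is continuous on this half plane. -/
theorem im_sub_im_eq_arg_sub_arg {p L : I → ℂ} (hL : Continuous L) (hp : ∀ u, exp (L u) = p u)
    {c : ℂ} (hc : c ≠ 0) (h : ∀ u, 0 ≤ (c * p u).re) :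
    (L 1).im - (L 0).im = arg (c * p 1) - arg (c * p 0) := by
  have hslit : ∀ u, c * p u ∈ slitPlane := by
    intro u
    have hne : c * p u ≠ 0 := mul_ne_zero hc (hp u ▸ exp_ne_zero _)
    rw [mem_slitPlane_iff]
    rcases (h u).lt_or_eq with h0 | h0
    · exact Or.inl h0
    · refine Or.inr fun h1 => hne (Complex.ext h0.symm h1)
  have hpc : Continuous p := by
    have : p = fun u => exp (L u) := funext fun u => (hp u).symm
    rw [this]
    fun_prop
  have hlog : Continuous fun u => log (c * p u) - log c :=
    ((continuous_const.mul hpc).clog hslit).sub continuous_const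
  -- Two continuous logarithms of the same curve differ by an integer multiple of `2πi`, which is
  -- constant by connectedness.
  have hint : ∀ u, ∃ k : ℤ, L u - (log (c * p u) - log c) = k * (2 * Real.pi * Complex.I) := by
    intro u
    have : exp (L u) = exp (log (c * p u) - log c) := by
      rw [exp_sub, exp_log (slitPlane_ne_zero (hslit u)), exp_log hc, hp, mul_div_cancel_left₀ _ hc]
    obtain ⟨k, hk⟩ := exp_eq_exp_iff_exists_int.1 this
    exact ⟨k, by rw [hk]; ring⟩
  choose k hk using hint
  have hkc : Continuous k := by
    rw [Int.isClosedEmbedding_coe_real.isEmbedding.continuous_iff]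
    have : ((↑) : ℤ → ℝ) ∘ k = fun u => (L u - (log (c * p u) - log c)).im / (2 * Real.pi) := by
      funext u
      rw [hk]
      have : (2 * Real.pi : ℝ) ≠ 0 := by positivity
      simp
    rw [this]
    exact (Complex.continuous_im.comp (hL.sub hlog)).div_const _
  have h01 : k 1 = k 0 := PreconnectedSpace.constant inferInstance hkc
  have e1 := congrArg Complex.im (hk 1)
  have e0 := congrArg Complex.im (hk 0)
  rw [h01, ← e0] at e1
  simp only [sub_im, log_im] at e1
  linarith

/-- Homotopy lifting for `exp`: a lift along the edge `{0} × I` extends over the square. -/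
theorem exists_continuous_log {f : I × I → ℂ} (hf : Continuous f) (h0 : ∀ z, f z ≠ 0) :
    ∃ L : I × I → ℂ, Continuous L ∧ ∀ z, Complex.exp (L z) = f z := by
  have cov := Complex.isCoveringMap_exp
  let H : C(I × I, {z : ℂ // z ≠ 0}) := ⟨fun z => ⟨f z, h0 z⟩, by fun_prop⟩
  obtain ⟨G, hG, -⟩ := cov.exists_path_lifts (H.comp (.prodMk (.const I 0) (.id I)))
    (Complex.log (f (0, 0))) (Subtype.ext (Complex.exp_log (h0 _)).symm)
  have hG0 : ∀ a, H (0, a) = ⟨Complex.exp (G a), Complex.exp_ne_zero _⟩ := fun a =>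
    (congrFun hG a).symm
  exact ⟨cov.liftHomotopy H G hG0, ContinuousMap.continuous _, fun z =>
    congrArg Subtype.val (congrFun (cov.liftHomotopy_lifts H G hG0) z)⟩

/-- The factors `-I` and `I` turn the upper and lower half planes into the right one, as
`im_sub_im_eq_arg_sub_arg` requires; these are the values at the corners. -/
theorem args_of_pos {z : ℂ} (h : 0 < z.re) (h' : z.im = 0) :
    (-Complex.I * z).arg = -(Real.pi / 2) ∧ (Complex.I * z).arg = Real.pi / 2 := by
  obtain ⟨x, rfl⟩ : ∃ x : ℝ, z = x := ⟨z.re, Complex.ext rfl (by simpa using h')⟩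
  rw [mul_comm, mul_comm Complex.I]
  simp only [Complex.ofReal_re] at h
  rw [Complex.arg_real_mul _ h, Complex.arg_real_mul _ h, Complex.arg_neg_I, Complex.arg_I]
  exact ⟨rfl, rfl⟩

theorem args_of_neg {z : ℂ} (h : z.re < 0) (h' : z.im = 0) :
    (-Complex.I * z).arg = Real.pi / 2 ∧ (Complex.I * z).arg = -(Real.pi / 2) := by
  obtain ⟨h1, h2⟩ := args_of_pos (z := -z) (by simpa using h) (by simpa using h')
  rw [neg_mul_neg] at h1
  rw [mul_neg, ← neg_mul] at h2
  exact ⟨h2, h1⟩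

/-- A map from the square to the plane minus the origin cannot send the lower edge to the lower half
plane, going from the positive to the negative real axis, and the other edges to the upper half
plane. -/
theorem exists_eq_zero_of_bottom {f : I × I → ℂ} (hf : Continuous f)
    (hb : ∀ s, (f (s, 0)).im ≤ 0) (hl : ∀ u, 0 ≤ (f (0, u)).im) (ht : ∀ s, 0 ≤ (f (s, 1)).im)
    (hr : ∀ u, 0 ≤ (f (1, u)).im) (h0 : 0 < (f (0, 0)).re) (h1 : (f (1, 0)).re < 0) :
    ∃ z, f z = 0 := by
  by_contra! hne
  obtain ⟨L, hL, hLf⟩ := exists_continuous_log hf hne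
  have up : ∀ z : ℂ, (-Complex.I * z).re = z.im := fun z => by simp
  have dn : ∀ z : ℂ, (Complex.I * z).re = -z.im := fun z => by simp
  have el := im_sub_im_eq_arg_sub_arg (p := fun u => f (0, u)) (L := fun u => L (0, u))
    (by fun_prop) (fun u => hLf _) (neg_ne_zero.2 Complex.I_ne_zero) (fun u => by rw [up]; exact hl u)
  have et := im_sub_im_eq_arg_sub_arg (p := fun u => f (u, 1)) (L := fun u => L (u, 1))
    (by fun_prop) (fun u => hLf _) (neg_ne_zero.2 Complex.I_ne_zero) (fun u => by rw [up]; exact ht u)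
  have er := im_sub_im_eq_arg_sub_arg (p := fun u => f (1, u)) (L := fun u => L (1, u))
    (by fun_prop) (fun u => hLf _) (neg_ne_zero.2 Complex.I_ne_zero) (fun u => by rw [up]; exact hr u)
  have eb := im_sub_im_eq_arg_sub_arg (p := fun u => f (u, 0)) (L := fun u => L (u, 0))
    (by fun_prop) (fun u => hLf _) Complex.I_ne_zero
    (fun u => by rw [dn]; linarith [hb u])
  obtain ⟨a0, b0⟩ := args_of_pos h0 (le_antisymm (hb 0) (hl 0))
  obtain ⟨a1, b1⟩ := args_of_neg h1 (le_antisymm (hb 1) (hr 0))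
  -- From `(0, 0)` to `(1, 0)` the argument changes by `π` along the three edges in the upper half
  -- plane but by `-π` along the lower edge.
  simp only [a0, a1, b0, b1] at el et er eb
  linarith [Real.pi_pos]

/-- A map from the square to the plane minus the origin cannot send the corners `(0, 0)` and `(1, 1)`
to the positive and the negative real axis, two edges between them to the upper half plane and
the other two to the lower half plane. -/
theorem exists_eq_zero_of_diagonal {f : I × I → ℂ} (hf : Continuous f)
    (hb : ∀ s, (f (s, 0)).im ≤ 0) (hl : ∀ u, 0 ≤ (f (0, u)).im) (ht : ∀ s, 0 ≤ (f (s, 1)).im)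
    (hr : ∀ u, (f (1, u)).im ≤ 0) (h0 : 0 < (f (0, 0)).re) (h1 : (f (1, 1)).re < 0) :
    ∃ z, f z = 0 := by
  by_contra! hne
  obtain ⟨L, hL, hLf⟩ := exists_continuous_log hf hne
  have up : ∀ z : ℂ, (-Complex.I * z).re = z.im := fun z => by simp
  have dn : ∀ z : ℂ, (Complex.I * z).re = -z.im := fun z => by simp
  have el := im_sub_im_eq_arg_sub_arg (p := fun u => f (0, u)) (L := fun u => L (0, u))
    (by fun_prop) (fun u => hLf _) (neg_ne_zero.2 Complex.I_ne_zero) (fun u => by rw [up]; exact hl u)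
  have et := im_sub_im_eq_arg_sub_arg (p := fun u => f (u, 1)) (L := fun u => L (u, 1))
    (by fun_prop) (fun u => hLf _) (neg_ne_zero.2 Complex.I_ne_zero) (fun u => by rw [up]; exact ht u)
  have er := im_sub_im_eq_arg_sub_arg (p := fun u => f (1, u)) (L := fun u => L (1, u))
    (by fun_prop) (fun u => hLf _) Complex.I_ne_zero
    (fun u => by rw [dn]; linarith [hr u])
  have eb := im_sub_im_eq_arg_sub_arg (p := fun u => f (u, 0)) (L := fun u => L (u, 0))
    (by fun_prop) (fun u => hLf _) Complex.I_ne_zero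
    (fun u => by rw [dn]; linarith [hb u])
  obtain ⟨a0, b0⟩ := args_of_pos h0 (le_antisymm (hb 0) (hl 0))
  obtain ⟨a1, b1⟩ := args_of_neg h1 (le_antisymm (hr 1) (ht 1))
  -- From `(0, 0)` to `(1, 1)` the two ways around the square change the argument by `π` and by
  -- `-π`.
  simp only [a0, a1, b0, b1] at el et er eb
  linarith [Real.pi_pos]

/-- The difference of two curves in the strip, as a map from the square to the plane. -/
def diffMap {x y x' y' : ℝ × I} (Γ : Path x y) (Δ : Path x' y') (z : I × I) : ℂ :=
  ⟨(Δ z.2).1 - (Γ z.1).1, (Δ z.2).2 - (Γ z.1).2⟩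

theorem continuous_diffMap {x y x' y' : ℝ × I} (Γ : Path x y) (Δ : Path x' y') :
    Continuous (diffMap Γ Δ) := by
  have : diffMap Γ Δ = fun z => (((Δ z.2).1 - (Γ z.1).1 : ℝ) : ℂ) +
      (((Δ z.2).2 - (Γ z.1).2 : ℝ) : ℂ) * Complex.I := by
    funext z
    exact Complex.ext (by simp [diffMap]) (by simp [diffMap])
  rw [this]
  fun_prop

theorem eq_of_diffMap_eq_zero {x y x' y' : ℝ × I} {Γ : Path x y} {Δ : Path x' y'} {z : I × I}
    (h : diffMap Γ Δ z = 0) : Γ z.1 = Δ z.2 := by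
  have h1 := congrArg Complex.re h
  have h2 := congrArg Complex.im h
  simp only [diffMap, Complex.zero_re, Complex.zero_im, sub_eq_zero] at h1 h2
  exact Prod.ext h1.symm (Subtype.ext h2.symm)

/-- Two curves across the strip meet if they change their order. -/
theorem exists_meet_of_bridging {a b a' b' : ℝ} (Γ : Path ((a, 0) : ℝ × I) (b, 1))
    (Δ : Path ((a', 0) : ℝ × I) (b', 1)) (h0 : a < a') (h1 : b' < b) : ∃ s u, Γ s = Δ u := by
  -- On each edge of the square one curve stays at an end point on the boundary of the strip, which
  -- fixes the sign of the height difference.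
  obtain ⟨z, hz⟩ := exists_eq_zero_of_diagonal (continuous_diffMap Γ Δ)
    (fun s => by simpa [diffMap] using (Γ s).2.2.1)
    (fun s => by simpa [diffMap] using (Δ s).2.2.1)
    (fun s => by simpa [diffMap] using (Γ s).2.2.2)
    (fun s => by simpa [diffMap] using (Δ s).2.2.2)
    (by simpa [diffMap] using h0) (by simpa [diffMap] using h1)
  exact ⟨z.1, z.2, eq_of_diffMap_eq_zero hz⟩

/-- A curve across the strip meets each curve between points on both sides of its starting point. -/
theorem exists_meet_of_bottom {a b c d : ℝ} (Γ : Path ((a, 0) : ℝ × I) (b, 0))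
    (Δ : Path ((c, 0) : ℝ × I) (d, 1)) (h0 : a < c) (h1 : c < b) : ∃ s u, Γ s = Δ u := by
  obtain ⟨z, hz⟩ := exists_eq_zero_of_bottom (continuous_diffMap Γ Δ)
    (fun s => by simpa [diffMap] using (Γ s).2.2.1)
    (fun s => by simpa [diffMap] using (Δ s).2.2.1)
    (fun s => by simpa [diffMap] using (Γ s).2.2.2)
    (fun s => by simpa [diffMap] using (Δ s).2.2.1)
    (by simpa [diffMap] using h0) (by simpa [diffMap] using h1)
  exact ⟨z.1, z.2, eq_of_diffMap_eq_zero hz⟩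

/-- A curve across the strip meets each curve between points on both sides of its end point. -/
theorem exists_meet_of_top {a b c d : ℝ} (Γ : Path ((a, 1) : ℝ × I) (b, 1))
    (Δ : Path ((c, 0) : ℝ × I) (d, 1)) (h0 : a < d) (h1 : d < b) : ∃ s u, Γ s = Δ u := by
  -- Reflecting the strip in its middle line and reversing `Δ` reduces to the bottom case.
  have hc : Continuous fun x : ℝ × I => ((x.1, σ x.2) : ℝ × I) := by fun_prop
  let Γ' : Path ((a, 0) : ℝ × I) (b, 0) := (Γ.map hc).cast (by simp) (by simp)
  let Δ' : Path ((d, 0) : ℝ × I) (c, 1) := (Δ.symm.map hc).cast (by simp) (by simp)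
  obtain ⟨s, u, h⟩ := exists_meet_of_bottom Γ' Δ' h0 h1
  refine ⟨s, σ u, ?_⟩
  simpa [Γ', Δ', Prod.ext_iff] using h

/-! ### Compatibility of curves -/

theorem IsSimpleCurve.symm {x y : Annulus} {γ : Path x y} (h : IsSimpleCurve γ) :
    IsSimpleCurve γ.symm := by
  have key : ∀ s ∈ Ioo (0 : I) 1, σ s ∈ Ioo (0 : I) 1 := fun s hs => by
    constructor
    · rw [unitInterval.pos_iff_ne_zero]
      exact fun h => hs.2.ne (by rw [← symm_symm s, h, symm_zero])
    · rw [unitInterval.lt_one_iff_ne_one]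
      exact fun h => hs.1.ne' (by rw [← symm_symm s, h, symm_one])
  refine ⟨fun s hs u hu hsu => ?_, fun s hs => h.2 _ (key s hs)⟩
  exact symm_bijective.1 (h.1 (key s hs) (key u hu) hsu)

theorem image_symm_Ioo {x y : Annulus} (γ : Path x y) :
    γ.symm '' Ioo 0 1 = γ '' Ioo 0 1 := by
  have : γ.symm '' Ioo 0 1 = γ '' (σ '' Ioo 0 1) := by rw [image_image]; rfl
  rw [this]
  congr 1
  ext s
  constructor
  · rintro ⟨u, hu, rfl⟩
    exact ⟨by simpa [← unitInterval.symm_one] using hu.2, by simpa [← unitInterval.symm_zero] using hu.1⟩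
  · intro hs
    refine ⟨σ s, ⟨?_, ?_⟩, symm_symm s⟩
    · simpa [← unitInterval.symm_one] using hs.2
    · simpa [← unitInterval.symm_zero] using hs.1

theorem Compatible.symm {e f : CurveClass} (h : Compatible e f) : Compatible f e := by
  obtain ⟨γ, δ, h1, h2, h3, h4, h5⟩ := h
  exact ⟨δ, γ, h2, h1, h4, h3, h5.symm⟩

theorem Compatible.reverse_left {e f : CurveClass} (h : Compatible e f) :
    Compatible e.reverse f := by
  obtain ⟨γ, δ, h1, h2, h3, h4, h5⟩ := h
  exact ⟨γ.symm, δ, congrArg Path.Homotopic.Quotient.symm h1, h2, h3.symm, h4,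
    (congrArg (Disjoint · _) (image_symm_Ioo γ)).mpr h5⟩

theorem Compatible.reverse_right {e f : CurveClass} (h : Compatible e f) :
    Compatible e f.reverse := h.symm.reverse_left.symm

/-- Compatible curves without common end points have disjoint lifts. -/
theorem Compatible.exists_disjoint_lifts {x y x' y' : ℝ × I}
    (h : Compatible (ofLift x y) (ofLift x' y')) (hx : x.2 = 0 ∨ x.2 = 1) (hy : y.2 = 0 ∨ y.2 = 1)
    (hx' : x'.2 = 0 ∨ x'.2 = 1) (hy' : y'.2 = 0 ∨ y'.2 = 1)
    (hxx : x ≠ x') (hxy : x ≠ y') (hyx : y ≠ x') (hyy : y ≠ y') :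
    ∃ (Γ : Path x y) (Δ : Path x' y'), ∀ s u, Γ s ≠ Δ u := by
  obtain ⟨γ, δ, h1, h2, h3, h4, h5⟩ := h
  obtain ⟨Γ, hΓ⟩ := exists_lift_of_mk_eq γ h1
  obtain ⟨Δ, hΔ⟩ := exists_lift_of_mk_eq δ h2
  refine ⟨Γ, Δ, fun s u hsu => ?_⟩
  have key : γ s = δ u := (hΓ s).symm.trans ((congrArg cover hsu).trans (hΔ u))
  have cases : ∀ v : I, v = 0 ∨ v = 1 ∨ v ∈ Ioo 0 1 := fun v => by
    rcases eq_or_ne v 0 with h0 | h0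
    · exact Or.inl h0
    rcases eq_or_ne v 1 with h1 | h1
    · exact Or.inr (Or.inl h1)
    exact Or.inr (Or.inr ⟨unitInterval.pos_iff_ne_zero.2 h0, unitInterval.lt_one_iff_ne_one.2 h1⟩)
  -- End points are distinct by assumption, interior points avoid the boundary, and two interior
  -- points would give a common point of the disjoint representatives.
  rcases cases s with rfl | rfl | hs <;> rcases cases u with rfl | rfl | hu
  · exact hxx (by simpa using hsu)
  · exact hxy (by simpa using hsu)
  · exact h4.2 u hu (by rw [← key, γ.source]; exact hx)
  · exact hyx (by simpa using hsu)
  · exact hyy (by simpa using hsu)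
  · exact h4.2 u hu (by rw [← key, γ.target]; exact hy)
  · exact h3.2 s hs (by rw [key, δ.source]; exact hx')
  · exact h3.2 s hs (by rw [key, δ.target]; exact hy')
  · exact disjoint_left.1 h5 ⟨s, hs, rfl⟩ ⟨u, hu, key.symm⟩

theorem Compatible.le_of_lt {a b a' b' : ℝ}
    (h : Compatible (ofLift (a, 0) (b, 1)) (ofLift (a', 0) (b', 1))) (ha : a < a') : b ≤ b' := by
  by_contra! hb
  obtain ⟨Γ, Δ, hne⟩ := h.exists_disjoint_lifts (by simp) (by simp) (by simp) (by simp)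
    (by simp [ha.ne]) (by simp) (by simp) (by simp [hb.ne'])
  obtain ⟨s, u, hsu⟩ := exists_meet_of_bridging Γ Δ ha hb
  exact hne s u hsu

theorem not_compatible_bottom {a b c d : ℝ} (h0 : a < c) (h1 : c < b) :
    ¬ Compatible (ofLift (a, 0) (b, 0)) (ofLift (c, 0) (d, 1)) := by
  intro h
  obtain ⟨Γ, Δ, hne⟩ := h.exists_disjoint_lifts (by simp) (by simp) (by simp) (by simp)
    (by simp [h0.ne]) (by simp) (by simp [h1.ne']) (by simp)
  obtain ⟨s, u, hsu⟩ := exists_meet_of_bottom Γ Δ h0 h1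
  exact hne s u hsu

theorem not_compatible_top {a b c d : ℝ} (h0 : a < d) (h1 : d < b) :
    ¬ Compatible (ofLift (a, 1) (b, 1)) (ofLift (c, 0) (d, 1)) := by
  intro h
  obtain ⟨Γ, Δ, hne⟩ := h.exists_disjoint_lifts (by simp) (by simp) (by simp) (by simp)
    (by simp) (by simp [h0.ne]) (by simp) (by simp [h1.ne'])
  obtain ⟨s, u, hsu⟩ := exists_meet_of_top Γ Δ h0 h1
  exact hne s u hsu

/-! ### Explicit representatives of bridging arcs -/

/-- A curve from `(a, 0)` to `(b, 1)` in the strip, a segment for `c = 0`. -/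
def bulge (a b c : ℝ) : Path ((a, 0) : ℝ × I) (b, 1) where
  toFun u := (a + u * (b - a) + c * (u * (1 - u)), u)
  continuous_toFun := by fun_prop
  source' := by simp
  target' := by simp

theorem isSimpleCurve_bulge (a b c : ℝ) : IsSimpleCurve ((bulge a b c).map cover.continuous) := by
  refine ⟨fun s _ u _ h => congrArg Prod.snd h, fun s hs h => ?_⟩
  rcases h with h | h
  · exact hs.1.ne' h
  · exact hs.2.ne h

/-- The height of a `bulge` equals its parameter, so two of them can only meet at equal parameters,
and only horizontal positions modulo `ℤ` matter. -/
theorem compatible_of_bulge {a b a' b' : ℝ} (c c' : ℝ)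
    (h : ∀ u ∈ Ioo (0 : I) 1, ∀ k : ℤ, (bulge a' b' c' u).1 ≠ (bulge a b c u).1 + k) :
    Compatible (ofLift (a, 0) (b, 1)) (ofLift (a', 0) (b', 1)) := by
  refine ⟨(bulge a b c).map cover.continuous, (bulge a' b' c').map cover.continuous,
    mk_map_cover _, mk_map_cover _, isSimpleCurve_bulge a b c, isSimpleCurve_bulge a' b' c',
    disjoint_left.2 ?_⟩
  rintro _ ⟨s, hs, rfl⟩ ⟨u, hu, hsu⟩
  obtain rfl : u = s := congrArg Prod.snd hsu
  obtain ⟨k, hk⟩ := cover_eq_iff.1 hsu.symm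
  exact h u hu k (congrArg Prod.fst hk)

/-- The condition `compatible` of a triangulation includes `e = f`, so one class needs two disjoint
representatives: a segment and its bulge by `u (1 - u)`, which is never an integer for `0 < u < 1`.
-/
theorem compatible_self (a b : ℝ) :
    Compatible (ofLift (a, 0) (b, 1)) (ofLift (a, 0) (b, 1)) := by
  refine compatible_of_bulge 0 1 fun u hu k hk => ?_
  have h0 : (0 : ℝ) < u := hu.1
  have h1 : (u : ℝ) < 1 := hu.2
  simp only [bulge, Path.coe_mk_mk] at hk
  have hk' : (u : ℝ) * (1 - u) = k := by linarith
  have : (0 : ℝ) < k := hk' ▸ mul_pos h0 (sub_pos.2 h1)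
  have h2 : (k : ℝ) < 1 := by rw [← hk']; nlinarith
  have h3 : 0 < k := by exact_mod_cast this
  have h4 : k < 1 := by exact_mod_cast h2
  omega

/-- The horizontal distance of a segment from a translate of another one is a convex combination of
the two end differences. As these have weakly equal signs, it vanishes inside only if both vanish,
and then the classes coincide. -/
theorem compatible_of_forall_mul_nonneg {a b a' b' : ℝ}
    (h : ∀ k : ℤ, 0 ≤ (a' - a - k) * (b' - b - k)) :
    Compatible (ofLift (a, 0) (b, 1)) (ofLift (a', 0) (b', 1)) := by
  by_cases hex : ∃ k : ℤ, a' - a = k ∧ b' - b = k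
  · obtain ⟨k, ha, hb⟩ := hex
    have : ofLift (a', 0) (b', 1) = ofLift (a, 0) (b, 1) := by
      rw [eq_comm, ofLift_eq_iff]
      exact ⟨k, Prod.ext (by simp only [shift]; linarith) rfl,
        Prod.ext (by simp only [shift]; linarith) rfl⟩
    rw [this]
    exact compatible_self a b
  · refine compatible_of_bulge 0 0 fun u hu k hk => ?_
    have h0 : (0 : ℝ) < u := hu.1
    have h1 : 0 < 1 - (u : ℝ) := sub_pos.2 hu.2
    simp only [bulge, Path.coe_mk_mk] at hk
    have hsum : (1 - (u : ℝ)) * (a' - a - k) + u * (b' - b - k) = 0 := by linarith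
    have hk0 := h k
    have e1 : (1 - (u : ℝ)) * (a' - a - k) ^ 2 + u * ((a' - a - k) * (b' - b - k)) = 0 := by
      linear_combination (a' - a - k) * hsum
    have ha : a' - a - k = 0 := by
      have := mul_nonneg h0.le hk0
      have h2 : (1 - (u : ℝ)) * (a' - a - k) ^ 2 = 0 :=
        le_antisymm (by linarith) (mul_nonneg h1.le (sq_nonneg _))
      exact pow_eq_zero_iff two_ne_zero |>.1 ((mul_eq_zero.1 h2).resolve_left h1.ne')
    have hb : b' - b - k = 0 := by
      rw [ha, mul_zero, zero_add] at hsum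
      exact (mul_eq_zero.1 hsum).resolve_left h0.ne'
    exact hex ⟨k, by linarith, by linarith⟩

/-! ### Marked points, boundary segments and bridging arcs -/

/-- The lifts of the outer marked points. -/
def lo (m : ℕ) (i : ℤ) : ℝ × I := ((i : ℝ) / m, 0)

/-- The lifts of the inner marked points. -/
def hi (n : ℕ) (j : ℤ) : ℝ × I := ((j : ℝ) / n, 1)

theorem lo_ne_hi (m n : ℕ) (i j : ℤ) : lo m i ≠ hi n j := fun h => by
  simpa [lo, hi] using congrArg Prod.snd h

theorem lo_injective (m : ℕ) [NeZero m] : Function.Injective (lo m) := by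
  intro i j h
  have hm : (m : ℝ) ≠ 0 := NeZero.ne _
  have h1 : (i : ℝ) / m = j / m := congrArg Prod.fst h
  field_simp at h1
  exact_mod_cast h1

theorem hi_injective (n : ℕ) [NeZero n] : Function.Injective (hi n) := by
  intro i j h
  have h1 : (hi n i).1 = (hi n j).1 := congrArg Prod.fst h
  exact lo_injective n (Prod.ext h1 rfl)

theorem shift_lo (m : ℕ) [NeZero m] (k i : ℤ) : shift k (lo m i) = lo m (i + k * m) := by
  have hm : (m : ℝ) ≠ 0 := NeZero.ne _
  refine Prod.ext ?_ rfl
  simp only [shift, lo]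
  push_cast
  field_simp

theorem shift_hi (n : ℕ) [NeZero n] (k j : ℤ) : shift k (hi n j) = hi n (j + k * n) := by
  have h : (shift k (lo n j)).1 = (lo n (j + k * n)).1 := congrArg Prod.fst (shift_lo n k j)
  exact Prod.ext h rfl

theorem cover_mem_marked_iff {m n : ℕ} [NeZero m] [NeZero n] {x : ℝ × I} :
    cover x ∈ marked m n ↔ (∃ i, x = lo m i) ∨ ∃ j, x = hi n j := by
  constructor
  · rintro (⟨i, hi⟩ | ⟨j, hj⟩)
    · obtain ⟨k, hk⟩ := cover_eq_iff.1 (show cover (lo m i) = cover x from hi)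
      exact Or.inl ⟨_, hk.trans (shift_lo m k i)⟩
    · obtain ⟨k, hk⟩ := cover_eq_iff.1 (show cover (AnnulusFrieze.hi n j) = cover x from hj)
      exact Or.inr ⟨_, hk.trans (shift_hi n k j)⟩
  · rintro (⟨i, rfl⟩ | ⟨j, rfl⟩)
    · exact Or.inl ⟨i, rfl⟩
    · exact Or.inr ⟨j, rfl⟩

/-- The points `x` and `y` are consecutive lifts of marked points on one boundary line. -/
def IsAdj (m n : ℕ) (x y : ℝ × I) : Prop :=
  ∃ i j : ℤ, (j = i + 1 ∨ i = j + 1) ∧ (x = lo m i ∧ y = lo m j ∨ x = hi n i ∧ y = hi n j)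

theorem IsAdj.symm {m n : ℕ} {x y : ℝ × I} (h : IsAdj m n x y) : IsAdj m n y x := by
  obtain ⟨i, j, hij, h⟩ := h
  exact ⟨j, i, hij.symm, h.imp And.symm And.symm⟩

theorem isBoundarySegment_ofLift_iff {m n : ℕ} [NeZero m] [NeZero n] {x y : ℝ × I} :
    IsBoundarySegment m n (ofLift x y) ↔ IsAdj m n x y := by
  constructor
  -- Stated for a free class `e`, so that induction on the boundary segment applies.
  · have key : ∀ e, IsBoundarySegment m n e → ∃ x y, e = ofLift x y ∧ IsAdj m n x y := by
      intro e he
      induction he with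
      | outer i => exact ⟨lo m i, lo m (i + 1), mk_circlePath _ _ _, i, i + 1, by simp⟩
      | inner j => exact ⟨hi n j, hi n (j + 1), mk_circlePath _ _ _, j, j + 1, by simp⟩
      | reverse e _ ih =>
        obtain ⟨x, y, rfl, h⟩ := ih
        exact ⟨y, x, ofLift_reverse x y, h.symm⟩
    intro h
    obtain ⟨x', y', he, i, j, hij, hxy⟩ := key _ h
    obtain ⟨k, rfl, rfl⟩ := ofLift_eq_iff.1 he.symm
    rcases hxy with ⟨rfl, rfl⟩ | ⟨rfl, rfl⟩
    · exact ⟨i + k * m, j + k * m, by omega, Or.inl ⟨shift_lo _ _ _, shift_lo _ _ _⟩⟩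
    · exact ⟨i + k * n, j + k * n, by omega, Or.inr ⟨shift_hi _ _ _, shift_hi _ _ _⟩⟩
  · have ho : ∀ i, IsBoundarySegment m n (ofLift (lo m i) (lo m (i + 1))) := fun i =>
      (mk_circlePath 0 ((i : ℝ) / m) (((i + 1 : ℤ) : ℝ) / m)) ▸ IsBoundarySegment.outer i
    have hi' : ∀ j, IsBoundarySegment m n (ofLift (hi n j) (hi n (j + 1))) := fun j =>
      (mk_circlePath 1 ((j : ℝ) / n) (((j + 1 : ℤ) : ℝ) / n)) ▸ IsBoundarySegment.inner j
    rintro ⟨i, j, rfl | rfl, ⟨rfl, rfl⟩ | ⟨rfl, rfl⟩⟩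
    · exact ho i
    · exact hi' i
    · exact ofLift_reverse _ _ ▸ (ho j).reverse
    · exact ofLift_reverse _ _ ▸ (hi' j).reverse

theorem not_isAdj_lo_hi (m n : ℕ) (i j : ℤ) : ¬ IsAdj m n (lo m i) (hi n j) := by
  rintro ⟨i', j', -, ⟨-, h⟩ | ⟨h, -⟩⟩
  · exact lo_ne_hi _ _ _ _ h.symm
  · exact lo_ne_hi _ _ _ _ h

/-- The arc that lifts to an arc from the `i`-th outer to the `j`-th inner marked point. -/
def bridge (m n : ℕ) (i j : ℤ) : CurveClass := ofLift (lo m i) (hi n j)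

theorem ofLift_ne_const {x y : ℝ × I} (h : x ≠ y) (p : Annulus) :
    ofLift x y ≠ ⟨p, p, .refl p⟩ := by
  intro he
  obtain rfl : cover x = p := congrArg CurveClass.source he
  rw [refl_eq_ofLift] at he
  obtain ⟨k, h1, h2⟩ := ofLift_eq_iff.1 he
  have h3 := h1.symm.trans h2
  have h5 : (shift k x).2 = (shift k y).2 := congrArg Prod.snd h3
  refine h (Prod.ext ?_ h5)
  have h4 : x.1 + k = y.1 + k := congrArg Prod.fst h3
  linarith

theorem IsArc.reverse {m n : ℕ} {e : CurveClass} (h : IsArc m n e) : IsArc m n e.reverse where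
  source_mem := h.target_mem
  target_mem := h.source_mem
  simple := by
    obtain ⟨γ, h1, h2⟩ := h.simple
    exact ⟨γ.symm, congrArg Path.Homotopic.Quotient.symm h1, h2.symm⟩
  not_const p hp := h.not_const p (by
    have := congrArg CurveClass.reverse hp
    obtain ⟨x, y, rfl⟩ := exists_eq_ofLift e
    rw [ofLift_reverse, ofLift_reverse] at this
    exact this)
  not_boundary hb := h.not_boundary (by
    have := IsBoundarySegment.reverse _ hb
    obtain ⟨x, y, rfl⟩ := exists_eq_ofLift e
    rwa [ofLift_reverse, ofLift_reverse] at this)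

theorem isArc_bridge (m n : ℕ) [NeZero m] [NeZero n] (i j : ℤ) : IsArc m n (bridge m n i j) where
  source_mem := cover_mem_marked_iff.2 (Or.inl ⟨i, rfl⟩)
  target_mem := cover_mem_marked_iff.2 (Or.inr ⟨j, rfl⟩)
  simple := ⟨_, mk_map_cover (bulge _ _ 0), isSimpleCurve_bulge _ _ 0⟩
  not_const := ofLift_ne_const (lo_ne_hi _ _ _ _)
  not_boundary := by
    rw [bridge, isBoundarySegment_ofLift_iff]
    exact not_isAdj_lo_hi m n i j

theorem bridge_eq_iff {m n : ℕ} [NeZero m] [NeZero n] {i j i' j' : ℤ} :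
    bridge m n i j = bridge m n i' j' ↔ ∃ k : ℤ, i' = i + k * m ∧ j' = j + k * n := by
  simp only [bridge, ofLift_eq_iff, shift_lo, shift_hi, (lo_injective m).eq_iff,
    (hi_injective n).eq_iff]

theorem bridge_ne_reverse (m n : ℕ) (i j i' j' : ℤ) :
    bridge m n i j ≠ (bridge m n i' j').reverse := by
  intro h
  have : (0 : I) = 1 := congrArg (fun e => e.source.2) h
  exact zero_ne_one this

/-- The passage from topology to combinatorics: crossing lifts obstruct compatibility, and segments
realize it otherwise. -/
theorem compatible_bridge_iff {m n : ℕ} [NeZero m] [NeZero n] {i j i' j' : ℤ} :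
    Compatible (bridge m n i j) (bridge m n i' j') ↔
      ∀ k : ℤ, (i < i' + k * m → j ≤ j' + k * n) ∧ (i' + k * m < i → j' + k * n ≤ j) := by
  have hm : (0 : ℝ) < m := Nat.cast_pos.2 (NeZero.pos m)
  have hn : (0 : ℝ) < n := Nat.cast_pos.2 (NeZero.pos n)
  constructor
  · intro h k
    have hb : bridge m n i' j' = bridge m n (i' + k * m) (j' + k * n) :=
      bridge_eq_iff.2 ⟨k, rfl, rfl⟩
    rw [hb] at h
    constructor
    · intro hi
      have := h.le_of_lt ((div_lt_div_iff_of_pos_right hm).2 (Int.cast_lt.2 hi))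
      exact_mod_cast (div_le_div_iff_of_pos_right hn).1 this
    · intro hi
      have := h.symm.le_of_lt ((div_lt_div_iff_of_pos_right hm).2 (Int.cast_lt.2 hi))
      exact_mod_cast (div_le_div_iff_of_pos_right hn).1 this
  · intro h
    refine compatible_of_forall_mul_nonneg fun k => ?_
    have e1 : (i' : ℝ) / m - i / m - k = ((i' - k * m - i : ℤ) : ℝ) / m := by
      push_cast; field_simp; ring
    have e2 : (j' : ℝ) / n - j / n - k = ((j' - k * n - j : ℤ) : ℝ) / n := by
      push_cast; field_simp; ring
    rw [e1, e2, div_mul_div_comm]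
    refine div_nonneg ?_ (mul_pos hm hn).le
    have := h (-k)
    rw [neg_mul, neg_mul] at this
    norm_cast
    rcases lt_trichotomy i (i' - k * m) with h1 | h1 | h1
    · have := this.1 (by omega)
      exact mul_nonneg (by omega) (by omega)
    · rw [← h1]; simp
    · have := this.2 (by omega)
      exact mul_nonneg_of_nonpos_of_nonpos (by omega) (by omega)

/-! ### Skeletal triangulations and monotone functions -/

/-- The bridging arcs from the `i`-th outer marked point to the inner marked points from `h i` to
`h (i + 1)`, in both orientations. -/
def fan (m n : ℕ) (h : ℤ → ℤ) : Set CurveClass :=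
  {e | ∃ i j, (h i ≤ j ∧ j ≤ h (i + 1)) ∧ (e = bridge m n i j ∨ e = (bridge m n i j).reverse)}

theorem bridge_reverse (m n : ℕ) (i j : ℤ) :
    (bridge m n i j).reverse = ofLift (hi n j) (lo m i) := ofLift_reverse _ _

theorem reverse_reverse (e : CurveClass) : e.reverse.reverse = e := by
  obtain ⟨x, y, rfl⟩ := exists_eq_ofLift e
  rw [ofLift_reverse, ofLift_reverse]

theorem reverse_mem_fan {m n : ℕ} {h : ℤ → ℤ} {e : CurveClass} (he : e ∈ fan m n h) :
    e.reverse ∈ fan m n h := by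
  obtain ⟨i, j, hij, rfl | rfl⟩ := he
  · exact ⟨i, j, hij, Or.inr rfl⟩
  · exact ⟨i, j, hij, Or.inl (reverse_reverse _)⟩

/-- The function `h` is quasi-periodic: it increases by `n` over each period `m`. -/
def IsQuasiPeriodic (m n : ℕ) (h : ℤ → ℤ) : Prop := ∀ i, h (i + m) = h i + n

theorem IsQuasiPeriodic.add_mul {m n : ℕ} {h : ℤ → ℤ} (hp : IsQuasiPeriodic m n h) (i k : ℤ) :
    h (i + k * m) = h i + k * n := by
  induction k using Int.induction_on with
  | zero => simp
  | succ k ih => rw [_root_.add_mul, one_mul, ← add_assoc, hp (i + k * m), ih]; ring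
  | pred k ih =>
    have := hp (i + (-(k : ℤ) - 1) * m)
    rw [show i + (-(k : ℤ) - 1) * m + m = i + -(k : ℤ) * m by ring, ih] at this
    linarith

theorem exists_add_mul_lt (m : ℕ) [NeZero m] (i i₀ : ℤ) : ∃ k : ℤ, i₀ + k * m < i := by
  have hm : (1 : ℤ) ≤ m := by exact_mod_cast NeZero.one_le
  refine ⟨-(|i - i₀| + 1), ?_⟩
  have := abs_nonneg (i - i₀)
  have := neg_abs_le (i - i₀)
  nlinarith

theorem exists_lt_add_mul (m : ℕ) [NeZero m] (i i₀ : ℤ) : ∃ k : ℤ, i < i₀ + k * m := by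
  obtain ⟨k, hk⟩ := exists_add_mul_lt m (-i) (-i₀)
  exact ⟨-k, by linarith⟩

theorem bridge_mem_fan_iff {m n : ℕ} [NeZero m] [NeZero n] {h : ℤ → ℤ}
    (hp : IsQuasiPeriodic m n h) {i j : ℤ} :
    bridge m n i j ∈ fan m n h ↔ h i ≤ j ∧ j ≤ h (i + 1) := by
  constructor
  · rintro ⟨i', j', hij, he | he⟩
    · obtain ⟨k, rfl, rfl⟩ := bridge_eq_iff.1 he
      rw [show i + k * m + 1 = i + 1 + k * m by ring, hp.add_mul, hp.add_mul] at hij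
      constructor <;> linarith
    · exact absurd he (bridge_ne_reverse _ _ _ _ _ _)
  · intro hij
    exact ⟨i, j, hij, Or.inl rfl⟩

/-- Every inner marked point lies on an arc of the fan: since `n > 0`, `h` is unbounded in both
directions, and the greatest `i` with `h i ≤ j` works. -/
theorem IsQuasiPeriodic.exists_le_le {m n : ℕ} [NeZero m] [NeZero n] {h : ℤ → ℤ}
    (hp : IsQuasiPeriodic m n h) (hh : Monotone h) (j : ℤ) : ∃ i, h i ≤ j ∧ j ≤ h (i + 1) := by
  obtain ⟨k, hk⟩ := exists_add_mul_lt n j (h 0)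
  obtain ⟨l, hl⟩ := exists_lt_add_mul n j (h 0)
  rw [← hp.add_mul] at hk hl
  obtain ⟨i, hi, hmax⟩ := Int.exists_greatest_of_bdd (P := fun i => h i ≤ j)
    ⟨0 + l * m, fun z hz => le_of_not_gt fun hlt => by linarith [hh hlt.le]⟩ ⟨_, hk.le⟩
  refine ⟨i, hi, le_of_not_gt fun hlt => ?_⟩
  have := hmax _ hlt.le
  omega

theorem IsArc.lo_lo_or_hi_hi {m n : ℕ} [NeZero m] [NeZero n] {x y : ℝ × I}
    (h : IsArc m n (ofLift x y)) :
    (∃ i i', x = lo m i ∧ y = lo m i' ∧ (i + 1 < i' ∨ i' + 1 < i)) ∨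
    (∃ i j, x = lo m i ∧ y = hi n j) ∨ (∃ i j, y = lo m i ∧ x = hi n j) ∨
    (∃ j j', x = hi n j ∧ y = hi n j' ∧ (j + 1 < j' ∨ j' + 1 < j)) := by
  have hne : x ≠ y := by
    rintro rfl
    exact h.not_const _ (refl_eq_ofLift x).symm
  have hb : ¬ IsAdj m n x y := fun hb => h.not_boundary (isBoundarySegment_ofLift_iff.2 hb)
  rcases cover_mem_marked_iff.1 h.source_mem with ⟨i, rfl⟩ | ⟨i, rfl⟩ <;>
    rcases cover_mem_marked_iff.1 h.target_mem with ⟨j, rfl⟩ | ⟨j, rfl⟩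
  · refine Or.inl ⟨i, j, rfl, rfl, ?_⟩
    have h1 : i ≠ j := fun h => hne (h ▸ rfl)
    have h2 : ¬ (j = i + 1 ∨ i = j + 1) := fun h => hb ⟨i, j, h, Or.inl ⟨rfl, rfl⟩⟩
    omega
  · exact Or.inr (Or.inl ⟨i, j, rfl, rfl⟩)
  · exact Or.inr (Or.inr (Or.inl ⟨j, i, rfl, rfl⟩))
  · refine Or.inr (Or.inr (Or.inr ⟨i, j, rfl, rfl, ?_⟩))
    have h1 : i ≠ j := fun h => hne (h ▸ rfl)
    have h2 : ¬ (j = i + 1 ∨ i = j + 1) := fun h => hb ⟨i, j, h, Or.inr ⟨rfl, rfl⟩⟩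
    omega

theorem not_compatible_lo_lo {m n : ℕ} [NeZero m] {i i' v j : ℤ} (h1 : i < v) (h2 : v < i') :
    ¬ Compatible (ofLift (lo m i) (lo m i')) (bridge m n v j) := by
  have hm : (0 : ℝ) < m := Nat.cast_pos.2 (NeZero.pos m)
  exact not_compatible_bottom ((div_lt_div_iff_of_pos_right hm).2 (Int.cast_lt.2 h1))
    ((div_lt_div_iff_of_pos_right hm).2 (Int.cast_lt.2 h2))

theorem not_compatible_hi_hi {m n : ℕ} [NeZero n] {j j' v i : ℤ} (h1 : j < v) (h2 : v < j') :
    ¬ Compatible (ofLift (hi n j) (hi n j')) (bridge m n i v) := by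
  have hn : (0 : ℝ) < n := Nat.cast_pos.2 (NeZero.pos n)
  exact not_compatible_top ((div_lt_div_iff_of_pos_right hn).2 (Int.cast_lt.2 h1))
    ((div_lt_div_iff_of_pos_right hn).2 (Int.cast_lt.2 h2))

/-- For `i < i'` the inner ends at `i` are at most `h (i + 1) ≤ h i'`, hence at most those at `i'`.
-/
theorem compatible_of_mem_fan {m n : ℕ} [NeZero m] [NeZero n] {h : ℤ → ℤ}
    (hp : IsQuasiPeriodic m n h) (hh : Monotone h) {e f : CurveClass} (he : e ∈ fan m n h)
    (hf : f ∈ fan m n h) : Compatible e f := by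
  obtain ⟨i, j, ⟨h1, h2⟩, he⟩ := he
  obtain ⟨i', j', ⟨h3, h4⟩, hf⟩ := hf
  have key : Compatible (bridge m n i j) (bridge m n i' j') := by
    refine compatible_bridge_iff.2 fun k => ⟨fun hlt => ?_, fun hlt => ?_⟩
    · have := hh (Int.add_one_le_of_lt hlt)
      rw [hp.add_mul] at this
      linarith
    · have := hh (Int.add_one_le_of_lt hlt)
      rw [show i' + k * m + 1 = i' + 1 + k * m by ring, hp.add_mul] at this
      linarith
  rcases he with rfl | rfl <;> rcases hf with rfl | rfl
  · exact key
  · exact key.reverse_right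
  · exact key.reverse_left
  · exact key.reverse_left.reverse_right

/-- A peripheral arc would cut off a marked point at which the fan has a bridging arc. A bridging
arc at `i` is squeezed between the arcs `(i - 1, h i)` and `(i + 1, h (i + 1))`. -/
theorem mem_fan_of_forall_compatible {m n : ℕ} [NeZero m] [NeZero n] {h : ℤ → ℤ}
    (hp : IsQuasiPeriodic m n h) (hh : Monotone h) {f : CurveClass} (hf : IsArc m n f)
    (hc : ∀ e ∈ fan m n h, Compatible e f) : f ∈ fan m n h := by
  have hlo : ∀ i, bridge m n i (h i) ∈ fan m n h := fun i =>
    (bridge_mem_fan_iff hp).2 ⟨le_rfl, hh (by omega)⟩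
  have hhi : ∀ j, ∃ i, bridge m n i j ∈ fan m n h := fun j =>
    (hp.exists_le_le hh j).imp fun i hi => (bridge_mem_fan_iff hp).2 hi
  have hbr : ∀ i j, (∀ e ∈ fan m n h, Compatible e (bridge m n i j)) →
      bridge m n i j ∈ fan m n h := by
    intro i j hc
    refine (bridge_mem_fan_iff hp).2 ⟨?_, ?_⟩
    · have hmem : bridge m n (i - 1) (h i) ∈ fan m n h :=
        (bridge_mem_fan_iff hp).2 ⟨hh (by omega), by rw [sub_add_cancel]⟩
      simpa using (compatible_bridge_iff.1 (hc _ hmem) 0).1 (by omega)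
    · simpa using (compatible_bridge_iff.1 (hc _ (hlo (i + 1))) 0).2 (by omega)
  obtain ⟨x, y, rfl⟩ := exists_eq_ofLift f
  rcases hf.lo_lo_or_hi_hi with ⟨i, i', rfl, rfl, hi | hi⟩ | ⟨i, j, rfl, rfl⟩ | ⟨i, j, rfl, rfl⟩ |
    ⟨j, j', rfl, rfl, hj | hj⟩
  · exact absurd (hc _ (hlo (i + 1))).symm (not_compatible_lo_lo (by omega) hi)
  · have := (hc _ (hlo (i' + 1))).symm.reverse_left
    rw [ofLift_reverse] at this
    exact absurd this (not_compatible_lo_lo (by omega) hi)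
  · exact hbr i j hc
  · rw [← bridge_reverse] at hc ⊢
    refine reverse_mem_fan (hbr i j fun e he => ?_)
    have := (hc e he).reverse_right
    rwa [reverse_reverse] at this
  · obtain ⟨i, hi⟩ := hhi (j + 1)
    exact absurd (hc _ hi).symm (not_compatible_hi_hi (by omega) hj)
  · obtain ⟨i, hi⟩ := hhi (j' + 1)
    have := (hc _ hi).symm.reverse_left
    rw [ofLift_reverse] at this
    exact absurd this (not_compatible_hi_hi (by omega) hj)

/-- The skeletal triangulation given by a monotone quasi-periodic function. -/
def fanTriangulation (m n : ℕ) [NeZero m] [NeZero n] (h : ℤ → ℤ) (hp : IsQuasiPeriodic m n h)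
    (hh : Monotone h) : Triangulation m n where
  arcs := fan m n h
  reverse_mem _ := reverse_mem_fan
  isArc := by
    rintro _ ⟨i, j, -, rfl | rfl⟩
    · exact isArc_bridge m n i j
    · exact (isArc_bridge m n i j).reverse
  compatible _ he _ hf := compatible_of_mem_fan hp hh he hf
  maximal _ := mem_fan_of_forall_compatible hp hh

theorem isSkeletal_fanTriangulation (m n : ℕ) [NeZero m] [NeZero n] (h : ℤ → ℤ)
    (hp : IsQuasiPeriodic m n h) (hh : Monotone h) :
    (fanTriangulation m n h hp hh).IsSkeletal := by
  rintro _ ⟨i, j, -, rfl | rfl⟩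
  · exact zero_ne_one (α := I)
  · exact one_ne_zero (α := I)

theorem Triangulation.IsSkeletal.exists_eq_bridge {m n : ℕ} [NeZero m] [NeZero n]
    {T : Triangulation m n} (hT : T.IsSkeletal) {e : CurveClass} (he : e ∈ T.arcs) :
    ∃ i j, bridge m n i j ∈ T.arcs ∧ (e = bridge m n i j ∨ e = (bridge m n i j).reverse) := by
  have hb := hT e he
  obtain ⟨x, y, rfl⟩ := exists_eq_ofLift e
  rcases (T.isArc _ he).lo_lo_or_hi_hi with ⟨i, i', rfl, rfl, -⟩ | ⟨i, j, rfl, rfl⟩ |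
    ⟨i, j, rfl, rfl⟩ | ⟨j, j', rfl, rfl, -⟩
  · exact absurd rfl hb
  · exact ⟨i, j, he, Or.inl rfl⟩
  · refine ⟨i, j, ?_, Or.inr (bridge_reverse _ _ _ _).symm⟩
    have := T.reverse_mem _ he
    rwa [ofLift_reverse] at this
  · exact absurd rfl hb

/-- Each skeletal triangulation is given by a monotone quasi-periodic function. -/
theorem Triangulation.IsSkeletal.exists_arcs_eq_fan {m n : ℕ} [NeZero m] [NeZero n]
    {T : Triangulation m n} (hT : T.IsSkeletal) :
    ∃ h, IsQuasiPeriodic m n h ∧ Monotone h ∧ T.arcs = fan m n h := by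
  let A : ℤ → ℤ → Prop := fun i j => bridge m n i j ∈ T.arcs
  have hper : ∀ {i j}, A i j → ∀ k : ℤ, A (i + k * m) (j + k * n) := fun {i j} hA k => by
    have : bridge m n i j = bridge m n (i + k * m) (j + k * n) := bridge_eq_iff.2 ⟨k, rfl, rfl⟩
    change bridge m n _ _ ∈ T.arcs
    rwa [← this]
  have hcross : ∀ {i j i' j'}, A i j → A i' j' → i < i' → j ≤ j' := fun hA hA' hlt => by
    simpa using (compatible_bridge_iff.1 (T.compatible _ hA _ hA') 0).1 (by simpa using hlt)
  -- As all arcs of `T` are bridging, maximality reduces to the order condition on integer pairs.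
  have hmax : ∀ i j, (∀ i' j', A i' j' → (i < i' → j ≤ j') ∧ (i' < i → j' ≤ j)) → A i j := by
    intro i j hij
    refine T.maximal _ (isArc_bridge m n i j) fun e he => ?_
    obtain ⟨i', j', hA, he⟩ := hT.exists_eq_bridge he
    have key : Compatible (bridge m n i' j') (bridge m n i j) :=
      (compatible_bridge_iff.2 fun k => hij _ _ (hper hA k)).symm
    rcases he with rfl | rfl
    · exact key
    · exact key.reverse_left
  -- An empty collection is not maximal.
  obtain ⟨i₀, j₀, h₀⟩ : ∃ i j, A i j := by
    by_contra! hno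
    exact hno 0 0 (hmax 0 0 fun i' j' hA => absurd hA (hno i' j'))
  -- `h i` is to be the rightmost inner end of the arcs starting strictly left of `i`; translates of
  -- `(i₀, j₀)` show that such arcs exist and bound their ends.
  have hex : ∀ i, ∃ b, (∃ i' < i, A i' b) ∧ ∀ z, (∃ i' < i, A i' z) → z ≤ b := by
    intro i
    obtain ⟨k, hk⟩ := exists_add_mul_lt m i i₀
    obtain ⟨l, hl⟩ := exists_lt_add_mul m i i₀
    exact Int.exists_greatest_of_bdd
      ⟨j₀ + l * n, fun z ⟨i', hi', hA⟩ => hcross hA (hper h₀ l) (hi'.trans hl)⟩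
      ⟨_, _, hk, hper h₀ k⟩
  choose h hh hhmax using hex
  have hle : ∀ i k, h i + k * n ≤ h (i + k * m) := fun i k => by
    obtain ⟨i', hi', hA⟩ := hh i
    exact hhmax _ _ ⟨_, by omega, hper hA k⟩
  refine ⟨h, fun i => le_antisymm ?_ (by simpa using hle i 1), fun i k hik => ?_, ?_⟩
  -- The reverse inequality is the same one for the translation by `-1`.
  · have := hle (i + m) (-1)
    simp only [neg_mul, one_mul, add_neg_cancel_right] at this
    linarith
  · obtain ⟨i', hi', hA⟩ := hh i
    exact hhmax _ _ ⟨i', by omega, hA⟩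
  · have hA : ∀ i j, A i j ↔ h i ≤ j ∧ j ≤ h (i + 1) := by
      intro i j
      constructor
      · intro hA
        obtain ⟨i', hi', hA'⟩ := hh i
        exact ⟨hcross hA' hA hi', hhmax _ _ ⟨i, by omega, hA⟩⟩
      · rintro ⟨h1, h2⟩
        refine hmax i j fun i' j' hA => ⟨fun hlt => ?_, fun hlt => (hhmax i j' ⟨i', hlt, hA⟩).trans h1⟩
        -- The value `h (i + 1)` is attained by an arc from some `i'' ≤ i`, which no arc further
        -- right crosses.
        obtain ⟨i'', hi'', hA''⟩ := hh (i + 1)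
        rcases (show i'' ≤ i by omega).lt_or_eq with hlt' | rfl
        · exact h2.trans (hcross hA'' hA (hlt'.trans hlt))
        · exact h2.trans (hcross hA'' hA hlt)
    ext e
    constructor
    · intro he
      obtain ⟨i, j, hij, he⟩ := hT.exists_eq_bridge he
      exact ⟨i, j, (hA i j).1 hij, he⟩
    · rintro ⟨i, j, hij, rfl | rfl⟩
      · exact (hA i j).2 hij
      · exact T.reverse_mem _ ((hA i j).2 hij)

/-! ### Counting triangles -/

theorem isSide_lo_iff {m n : ℕ} [NeZero m] [NeZero n] {h : ℤ → ℤ} (hp : IsQuasiPeriodic m n h)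
    {T : Triangulation m n} (hT : T.arcs = fan m n h) {i : ℤ} {y : ℝ × I} :
    T.IsSide (ofLift (lo m i) y) ↔
      y = lo m (i + 1) ∨ y = lo m (i - 1) ∨ ∃ j, y = hi n j ∧ h i ≤ j ∧ j ≤ h (i + 1) := by
  rw [Triangulation.IsSide, hT, isBoundarySegment_ofLift_iff]
  constructor
  · rintro (hy | ⟨i', j', hij, ⟨h1, rfl⟩ | ⟨h1, -⟩⟩)
    · obtain ⟨j, rfl⟩ : ∃ j, y = hi n j := by
        obtain ⟨i', j', -, he | he⟩ := hy
        · obtain ⟨k, -, hk⟩ := ofLift_eq_iff.1 he.symm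
          exact ⟨_, hk.trans (shift_hi n k j')⟩
        · rw [bridge_reverse] at he
          obtain ⟨k, hk, -⟩ := ofLift_eq_iff.1 he.symm
          exact absurd (hk.trans (shift_hi n k j')) (lo_ne_hi _ _ _ _)
      exact Or.inr (Or.inr ⟨j, rfl, (bridge_mem_fan_iff hp).1 hy⟩)
    · obtain rfl := lo_injective m h1
      rcases hij with rfl | rfl
      · exact Or.inl rfl
      · exact Or.inr (Or.inl (by rw [add_sub_cancel_right]))
    · exact absurd h1 (lo_ne_hi _ _ _ _)
  · rintro (rfl | rfl | ⟨j, rfl, hj⟩)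
    · exact Or.inr ⟨i, i + 1, Or.inl rfl, Or.inl ⟨rfl, rfl⟩⟩
    · exact Or.inr ⟨i, i - 1, Or.inr (sub_add_cancel i 1).symm, Or.inl ⟨rfl, rfl⟩⟩
    · exact Or.inl ((bridge_mem_fan_iff hp).2 hj)

theorem isSide_lo_lo_iff {m n : ℕ} [NeZero m] [NeZero n] {h : ℤ → ℤ} (hp : IsQuasiPeriodic m n h)
    {T : Triangulation m n} (hT : T.arcs = fan m n h) {i i' : ℤ} :
    T.IsSide (ofLift (lo m i) (lo m i')) ↔ i' = i + 1 ∨ i' = i - 1 := by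
  rw [isSide_lo_iff hp hT, (lo_injective m).eq_iff, (lo_injective m).eq_iff]
  simp [lo_ne_hi]

theorem isSide_lo_hi_iff {m n : ℕ} [NeZero m] [NeZero n] {h : ℤ → ℤ} (hp : IsQuasiPeriodic m n h)
    {T : Triangulation m n} (hT : T.arcs = fan m n h) {i j : ℤ} :
    T.IsSide (ofLift (lo m i) (hi n j)) ↔ h i ≤ j ∧ j ≤ h (i + 1) := by
  rw [isSide_lo_iff hp hT]
  simp [(lo_ne_hi _ _ _ _).symm, (hi_injective n).eq_iff]

theorem isSide_hi_hi_iff {m n : ℕ} [NeZero m] [NeZero n] {h : ℤ → ℤ}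
    {T : Triangulation m n} (hT : T.arcs = fan m n h) {j j' : ℤ} :
    T.IsSide (ofLift (hi n j) (hi n j')) ↔ j' = j + 1 ∨ j = j' + 1 := by
  rw [Triangulation.IsSide, hT, isBoundarySegment_ofLift_iff]
  constructor
  · rintro (⟨i, k, -, he | he⟩ | ⟨i, k, hik, ⟨h1, -⟩ | ⟨h1, h2⟩⟩)
    · obtain ⟨l, hl, -⟩ := ofLift_eq_iff.1 he
      exact absurd (hl.trans (shift_hi n l j)) (lo_ne_hi _ _ _ _)
    · rw [bridge_reverse] at he
      obtain ⟨l, -, hl⟩ := ofLift_eq_iff.1 he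
      exact absurd (hl.trans (shift_hi n l j')) (lo_ne_hi _ _ _ _)
    · exact absurd h1.symm (lo_ne_hi _ _ _ _)
    · rwa [hi_injective n h1, hi_injective n h2]
  · intro hj
    exact Or.inr ⟨j, j', hj, Or.inr ⟨rfl, rfl⟩⟩

theorem Triangulation.isSide_symm {m n : ℕ} {T : Triangulation m n} {x y : ℝ × I}
    (h : T.IsSide (ofLift x y)) : T.IsSide (ofLift y x) := by
  rw [← ofLift_reverse]
  exact h.imp (T.reverse_mem _) (IsBoundarySegment.reverse _)

/-- The corners of triangles at a lift of an outer marked point, given by the end points of their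
two sides. -/
theorem setOf_corner_eq {m n : ℕ} [NeZero m] [NeZero n] {h : ℤ → ℤ} (hp : IsQuasiPeriodic m n h)
    (hh : Monotone h) {T : Triangulation m n} (hT : T.arcs = fan m n h) (i : ℤ) :
    {c : Sym2 (ℝ × I) | ∃ y z, c = s(y, z) ∧ T.IsSide (ofLift (lo m i) y) ∧
      T.IsSide (ofLift (lo m i) z) ∧ T.IsSide (ofLift y z)} =
    insert s(lo m (i - 1), hi n (h i)) (insert s(lo m (i + 1), hi n (h (i + 1)))
      ((fun j => s(hi n j, hi n (j + 1))) '' Ico (h i) (h (i + 1)))) := by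
  -- The fans at neighbouring outer points share a single inner end, so each outer segment lies in
  -- one triangle.
  have hlohi : ∀ i' j, (i' = i + 1 ∨ i' = i - 1) → h i ≤ j → j ≤ h (i + 1) →
      T.IsSide (ofLift (lo m i') (hi n j)) →
      i' = i - 1 ∧ j = h i ∨ i' = i + 1 ∧ j = h (i + 1) := by
    intro i' j hi' h1 h2 hs
    rw [isSide_lo_hi_iff hp hT] at hs
    rcases hi' with rfl | rfl
    · exact Or.inr ⟨rfl, le_antisymm h2 hs.1⟩
    · rw [sub_add_cancel] at hs
      exact Or.inl ⟨rfl, le_antisymm hs.2 h1⟩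
  ext c
  constructor
  · rintro ⟨y, z, rfl, hy, hz, hyz⟩
    have hcase : ∀ {y}, T.IsSide (ofLift (lo m i) y) →
        (∃ i', y = lo m i' ∧ (i' = i + 1 ∨ i' = i - 1)) ∨
        ∃ j, y = hi n j ∧ h i ≤ j ∧ j ≤ h (i + 1) := fun hy => by
      rcases (isSide_lo_iff hp hT).1 hy with h | h | h
      · exact Or.inl ⟨_, h, Or.inl rfl⟩
      · exact Or.inl ⟨_, h, Or.inr rfl⟩
      · exact Or.inr h
    rcases hcase hy with ⟨i', rfl, hi'⟩ | ⟨j, rfl, h1, h2⟩ <;>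
      rcases hcase hz with ⟨i'', rfl, hi''⟩ | ⟨j', rfl, h1', h2'⟩
    -- In the strip the indices of two outer neighbours of `i` differ by `0` or `2`, whatever `m`
    -- is.
    · rw [isSide_lo_lo_iff hp hT] at hyz
      omega
    · rcases hlohi _ _ hi' h1' h2' hyz with ⟨rfl, rfl⟩ | ⟨rfl, rfl⟩
      · exact Or.inl rfl
      · exact Or.inr (Or.inl rfl)
    · rcases hlohi _ _ hi'' h1 h2 (Triangulation.isSide_symm hyz) with ⟨rfl, rfl⟩ | ⟨rfl, rfl⟩
      · exact Or.inl Sym2.eq_swap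
      · exact Or.inr (Or.inl Sym2.eq_swap)
    · refine Or.inr (Or.inr ?_)
      rcases (isSide_hi_hi_iff hT).1 hyz with rfl | rfl
      · exact ⟨j, ⟨h1, by omega⟩, rfl⟩
      · exact ⟨j', ⟨h1', by omega⟩, Sym2.eq_swap⟩
  · have hle : h i ≤ h (i + 1) := hh (by omega)
    have hle' : h (i - 1) ≤ h i := hh (by omega)
    have hle'' : h (i + 1) ≤ h (i + 1 + 1) := hh (by omega)
    rintro (rfl | rfl | ⟨j, ⟨h1, h2⟩, rfl⟩)
    · refine ⟨_, _, rfl, ?_, ?_, ?_⟩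
      · simp [isSide_lo_lo_iff hp hT]
      · simpa [isSide_lo_hi_iff hp hT] using hle
      · simpa [isSide_lo_hi_iff hp hT] using hle'
    · refine ⟨_, _, rfl, ?_, ?_, ?_⟩
      · simp [isSide_lo_lo_iff hp hT]
      · simpa [isSide_lo_hi_iff hp hT] using hle
      · simpa [isSide_lo_hi_iff hp hT] using hle''
    · refine ⟨_, _, rfl, ?_, ?_, ?_⟩
      · rw [isSide_lo_hi_iff hp hT]; omega
      · rw [isSide_lo_hi_iff hp hT]; omega
      · rw [isSide_hi_hi_iff hT]; omega

/-- The bijection `endCls x` moves the count to the strip, where the third side `e⁻¹ f` joins the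
two end points. -/
theorem trianglesAt_cover {m n : ℕ} (T : Triangulation m n) (x : ℝ × I) :
    T.trianglesAt (cover x) = {c : Sym2 (ℝ × I) | ∃ y z, c = s(y, z) ∧ T.IsSide (ofLift x y) ∧
      T.IsSide (ofLift x z) ∧ T.IsSide (ofLift y z)}.ncard := by
  have hthird : ∀ y z, (⟨(endCls x y).1, (endCls x z).1,
      (endCls x y).2.symm.trans (endCls x z).2⟩ : CurveClass) = ofLift y z := fun y z => by
    change (⟨cover y, cover z, (liftCls x y).symm.trans (liftCls x z)⟩ : CurveClass) = _
    rw [liftCls_symm, liftCls_trans]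
    rfl
  rw [Triangulation.trianglesAt, ← ncard_image_of_injective _ (Sym2.map.injective (endCls_injective x))]
  congr 1
  ext c
  constructor
  · rintro ⟨e, f, rfl, he, hf, hef⟩
    obtain ⟨y, rfl⟩ := endCls_surjective x e
    obtain ⟨z, rfl⟩ := endCls_surjective x f
    rw [hthird] at hef
    exact ⟨s(y, z), ⟨y, z, rfl, he, hf, hef⟩, rfl⟩
  · rintro ⟨_, ⟨y, z, rfl, hy, hz, hyz⟩, rfl⟩
    exact ⟨endCls x y, endCls x z, rfl, hy, hz, (hthird y z).symm ▸ hyz⟩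

/-- The summand `2` counts the triangles on the two outer segments at `i`; each inner segment
between `h i` and `h (i + 1)` gives one more. -/
theorem trianglesAt_outerPt {m n : ℕ} [NeZero m] [NeZero n] {h : ℤ → ℤ}
    (hp : IsQuasiPeriodic m n h) (hh : Monotone h) {T : Triangulation m n}
    (hT : T.arcs = fan m n h) (i : ℤ) :
    (T.trianglesAt (outerPt m i) : ℤ) = h (i + 1) - h i + 2 := by
  have hle : h i ≤ h (i + 1) := hh (by omega)
  have hinj : Function.Injective fun j => s(hi n j, hi n (j + 1)) := by
    intro j j' hj
    simp only [Sym2.eq_iff, (hi_injective n).eq_iff] at hj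
    omega
  have hfin : ((fun j => s(hi n j, hi n (j + 1))) '' Ico (h i) (h (i + 1))).Finite :=
    (finite_Ico _ _).image _
  change (T.trianglesAt (cover (lo m i)) : ℤ) = _
  rw [trianglesAt_cover, setOf_corner_eq hp hh hT, ncard_insert_of_notMem _ (hfin.insert _),
    ncard_insert_of_notMem _ hfin, ncard_image_of_injective _ hinj, ← Finset.coe_Ico,
    ncard_coe_finset, Int.card_Ico]
  · push_cast
    rw [Int.toNat_of_nonneg (by omega)]
    ring
  · rintro ⟨j, -, hj⟩
    simp [(lo_ne_hi _ _ _ _).symm] at hj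
  · rintro (hj | ⟨j, -, hj⟩)
    · have hne : i - 1 ≠ i + 1 := by omega
      simp [lo_ne_hi, (lo_injective m).eq_iff, hne] at hj
    · simp [(lo_ne_hi _ _ _ _).symm] at hj

theorem outerQuiddity_intCast {m n : ℕ} [NeZero m] [NeZero n] {h : ℤ → ℤ}
    (hp : IsQuasiPeriodic m n h) (hh : Monotone h) {T : Triangulation m n}
    (hT : T.arcs = fan m n h) (i : ℤ) :
    (T.outerQuiddity (i : ZMod m) : ℤ) = h (i + 1) - h i + 2 := by
  rw [Triangulation.outerQuiddity, trianglesAt_outerPt hp hh hT, ZMod.val_intCast]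
  have h1 := hp.add_mul (i % m) (i / m)
  have h2 := hp.add_mul (i % m + 1) (i / m)
  rw [Int.emod_add_ediv_mul] at h1
  rw [add_right_comm, Int.emod_add_ediv_mul] at h2
  linarith

/-! ### Quiddity sequences -/

/-- The sum of the entries of `g` from `0` to `i - 1`, extended to negative `i`. -/
def partialSum (g : ℤ → ℤ) (i : ℤ) : ℤ := ∑ j ∈ Finset.Ico 0 i, g j - ∑ j ∈ Finset.Ico i 0, g j

theorem partialSum_add_one (g : ℤ → ℤ) (i : ℤ) : partialSum g (i + 1) = partialSum g i + g i := by
  unfold partialSum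
  rcases le_or_gt 0 i with hi | hi
  · rw [← Finset.insert_Ico_right_eq_Ico_add_one hi, Finset.sum_insert (by simp),
      Finset.Ico_eq_empty_of_le hi, Finset.Ico_eq_empty_of_le (show (0 : ℤ) ≤ i + 1 by omega)]
    simp
    ring
  · rw [Finset.Ico_eq_empty_of_le hi.le, Finset.Ico_eq_empty_of_le (show i + 1 ≤ (0 : ℤ) by omega),
      ← Finset.insert_Ico_add_one_left_eq_Ico hi, Finset.sum_insert (by simp)]
    simp

theorem eq_add_of_forall_sub_eq {f g : ℤ → ℤ} (h : ∀ i, f (i + 1) - f i = g (i + 1) - g i)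
    (i : ℤ) : f i = g i + (f 0 - g 0) := by
  induction i using Int.induction_on with
  | zero => ring
  | succ k ih => linarith [h k]
  | pred k ih =>
    have := h (-(k : ℤ) - 1)
    rw [sub_add_cancel] at this
    linarith

/-- Positivity of the frieze excludes `0`, and `reduced` excludes `1`. -/
theorem IsSkeletalQuiddity.two_le {m : ℕ} {q : ZMod m → ℕ} (hq : IsSkeletalQuiddity m q) (i : ℤ) :
    2 ≤ q (i : ZMod m) := by
  obtain ⟨F, hF, hFq⟩ := hq.quiddity
  have h1 := hF.pos 0 i
  rw [zero_add, hFq] at h1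
  have h2 := hq.reduced i
  omega

/-- A skeletal quiddity sequence is the sequence of increments of a quasi-periodic function. -/
theorem IsSkeletalQuiddity.exists_quasiPeriodic {m : ℕ} [NeZero m] {q : ZMod m → ℕ}
    (hq : IsSkeletalQuiddity m q) :
    ∃ n : ℕ, n ≠ 0 ∧ ∃ h : ℤ → ℤ, IsQuasiPeriodic m n h ∧ Monotone h ∧
      ∀ i : ℤ, h (i + 1) - h i + 2 = q (i : ZMod m) := by
  let h := partialSum fun i : ℤ => (q (i : ZMod m) : ℤ) - 2
  have hstep : ∀ i : ℤ, h (i + 1) - h i + 2 = q (i : ZMod m) := fun i => by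
    simp only [h, partialSum_add_one]
    ring
  have hmono : Monotone h := monotone_int_of_le_succ fun i => by
    have h1 := hstep i
    have h2 := hq.two_le i
    omega
  have h0 : h 0 = 0 := by simp [h, partialSum]
  have hper : ∀ i, h (i + m) = h i + h m := fun i => by
    have := eq_add_of_forall_sub_eq (f := fun i => h (i + m)) (g := h) (fun i => by
      have h1 := hstep i
      have h2 := hstep (i + m)
      push_cast at h2
      rw [ZMod.natCast_self, add_zero] at h2
      rw [add_right_comm]
      linarith) i
    simpa [h0] using this
  -- An entry different from `2` is at least `3` and makes `h` grow over a period; this gives `n ≥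
  -- 1`.
  have hpos : 0 < h m := by
    obtain ⟨i, hi⟩ := hq.nontrivial
    have hi' : ((i.val : ℤ) : ZMod m) = i := by simp
    have h1 := hstep i.val
    have h2 := hq.two_le i.val
    rw [hi'] at h1 h2
    have h3 : h 0 ≤ h i.val := hmono (by omega)
    have h4 : h (i.val + 1) ≤ h m := hmono (by have := ZMod.val_lt i; omega)
    omega
  refine ⟨(h m).toNat, by omega, h, fun i => ?_, hmono, hstep⟩
  rw [hper, Int.toNat_of_nonneg hpos.le]

/-! ### Rotations acting on fans -/

theorem rotateLift_lo (m : ℕ) (c i : ℤ) (β : ℝ) :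
    rotateLift (-(c : ℝ) / m) β (lo m i) = lo m (i - c) := by
  refine Prod.ext ?_ rfl
  simp only [rotateLift, lo, Icc.coe_zero]
  push_cast
  ring

theorem rotateLift_hi (n : ℕ) (k j : ℤ) (α : ℝ) :
    rotateLift α ((k : ℝ) / n) (hi n j) = hi n (j + k) := by
  refine Prod.ext ?_ rfl
  simp only [rotateLift, hi, Icc.coe_one]
  push_cast
  ring

/-- The rotation sends the arc `(i, j)` to `(i - c, j + k)`. -/
theorem image_fan_rotate (m n : ℕ) (h : ℤ → ℤ) (c k : ℤ) :
    CurveClass.map (rotate (-(c : ℝ) / m) ((k : ℝ) / n) : C(Annulus, Annulus)) '' fan m n h =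
      fan m n fun i => h (i + c) + k := by
  have key : ∀ i j, (bridge m n i j).map
      (rotate (-(c : ℝ) / m) ((k : ℝ) / n) : C(Annulus, Annulus)) = bridge m n (i - c) (j + k) :=
    fun i j => by rw [bridge, map_rotate_ofLift, rotateLift_lo, rotateLift_hi, bridge]
  have key' : ∀ i j, (bridge m n i j).reverse.map
      (rotate (-(c : ℝ) / m) ((k : ℝ) / n) : C(Annulus, Annulus)) =
        (bridge m n (i - c) (j + k)).reverse :=
    fun i j => by
      rw [bridge_reverse, map_rotate_ofLift, rotateLift_lo, rotateLift_hi, bridge_reverse]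
  ext e
  constructor
  · rintro ⟨_, ⟨i, j, ⟨h1, h2⟩, rfl | rfl⟩, rfl⟩
    · exact ⟨i - c, j + k, by simpa [← add_sub_right_comm] using ⟨h1, h2⟩, Or.inl (key i j)⟩
    · exact ⟨i - c, j + k, by simpa [← add_sub_right_comm] using ⟨h1, h2⟩, Or.inr (key' i j)⟩
  · rintro ⟨i, j, ⟨h1, h2⟩, he⟩
    have hmem : h (i + c) ≤ j - k ∧ j - k ≤ h (i + c + 1) := by
      rw [add_right_comm]
      constructor <;> linarith
    rcases he with rfl | rfl
    · exact ⟨_, ⟨i + c, j - k, hmem, Or.inl rfl⟩, by rw [key]; simp⟩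
    · exact ⟨_, ⟨i + c, j - k, hmem, Or.inr rfl⟩, by rw [key']; simp⟩

end AnnulusFrieze

end

open AnnulusFrieze
theorem mainTheorem7 (m : ℕ) [NeZero m] (q : ZMod m → ℕ) (hq : IsSkeletalQuiddity m q) :
    ∃ (n : ℕ) (_ : NeZero n) (T : Triangulation m n),
      T.IsSkeletal ∧ T.outerQuiddity = q ∧
      ∀ (n' : ℕ) [NeZero n'] (T' : Triangulation m n') (c : ℤ),
        T'.IsSkeletal → (∀ i, T'.outerQuiddity i = q (i + (c : ZMod m))) →
        n' = n ∧ ∃ k : ℤ, T'.arcs =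
          CurveClass.map (rotate (-(c : ℝ) / m) ((k : ℝ) / n) : C(Annulus, Annulus)) '' T.arcs := by
  obtain ⟨n, hn, h, hp, hh, hstep⟩ := hq.exists_quasiPeriodic
  have : NeZero n := ⟨hn⟩
  refine ⟨n, this, fanTriangulation m n h hp hh, isSkeletal_fanTriangulation m n h hp hh, ?_, ?_⟩
  · funext i
    obtain ⟨i, rfl⟩ := ZMod.intCast_surjective i
    have := outerQuiddity_intCast hp hh (T := fanTriangulation m n h hp hh) rfl i
    rw [hstep] at this
    exact_mod_cast this
  · intro n' _ T' c hT' hq'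
    obtain ⟨h', hp', hh', harcs⟩ := hT'.exists_arcs_eq_fan
    -- Equal quiddities mean equal increments, so `h'` is the shifted `h` plus a constant, which
    -- serves as `k`.
    have hsub : ∀ i, h' i = h (i + c) + (h' 0 - h (0 + c)) :=
      eq_add_of_forall_sub_eq (g := fun i => h (i + c)) fun i => by
        have h1 := outerQuiddity_intCast hp' hh' harcs i
        have h2 := hstep (i + c)
        rw [hq', ← Int.cast_add, ← h2] at h1
        rw [add_right_comm i 1 c]
        linarith
    -- Both numbers are the growth of the function over one period.
    have hnn : n' = n := by
      have h1 := hp' 0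
      have h2 := hp c
      rw [hsub (0 + m), zero_add, zero_add, add_comm (m : ℤ) c, h2] at h1
      have : (n' : ℤ) = n := by linarith
      exact_mod_cast this
    subst hnn
    refine ⟨rfl, h' 0 - h (0 + c), ?_⟩
    change _ = _ '' fan m n' h
    rw [image_fan_rotate, harcs, ← funext hsub]
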